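/- **Setting.** For every $n$ let $G_n$ be a simple undirected graph on the units $[n]=\{1,\dots,n\}$ with adjacency matrix $A$, neighborhoods $\mathcal N_i$ and degrees $D_i=|\mathcal N_i|$, where $D_i\ge 1$ for all $i$ (for all large $n$). Let $[n]$ be partitioned into $K_n$ ego-clusters $E_1,\dots,E_{K_n}$, each consisting of a unit (its ego) and some of that unit's neighbors, and let $e(i)$ be the index of the cluster of $i$. The graphs and the partitions are non-random (all statements are conditional on them). Put $$R_{ik}=\frac{|\mathcal N_i\cap E_k|}{D_i},\qquad r_i=1-R_{ie(i)},\qquad \bar r_n=\frac1n\sum_{i=1}^n r_i,$$ $$b_n=\frac1n\sum_{i=1}^n\sum_{k\ne e(i)}R_{ik}^2+\frac1n\sum_{i=1}^n(r_i-\bar r_n)^2 .$$ Let $\mathcal K_i=\{k:(\mathcal N_i\cup\{i\})\cap E_k\ne\emptyset\}$, let $\Lambda\in\{0,1\}^{n\times n}$ have $\Lambda_{ij}=1$ if and only if $\mathcal K_i\cap\mathcal K_j\neq\emptyset$, and let $N_i=\{j:\Lambda_{ij}=1\}$. Cluster $k$ receives treatment $T^{\mathcal E}_k$, unit $i$ receives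 $T_i=T^{\mathcal E}_{e(i)}$, and the outcomes are $$Y_i=\alpha+\beta T_i+\gamma\rho_i+\epsilon_i,\qquad \rho_i=\frac1{D_i}\sum_{j}A_{ij}T_j,$$ with $\alpha,\beta,\gamma\in\mathbb R$ not depending on $n$. Let $X$ be the $n\times 3$ matrix with columns $1_n,T,\rho$, let $(\hat\alpha,\hat\beta,\hat\gamma)^{\mathrm T}=(X^{\mathrm T}X)^{-1}X^{\mathrm T}Y$ (set to $0$ where $X^{\mathrm T}X$ is singular), and let $\tau=\beta+\gamma$, $\hat\tau=\hat\beta+\hat\gamma$. **Theorem.** Assume: 1. $\max_k|E_k|=o(n)$, and for every $n$ the treatments $T^{\mathcal E}_1,\dots,T^{\mathcal E}_{K_n}$ are i.i.d. Bernoulli$(1/2)$; 2. for every $n$ the errors $\epsilon_1,\dots,\epsilon_n$ are i.i.d. with mean $0$ and variance $\sigma_\epsilon^2>0$ not depending on $n$, are independent of $T=(T_1,\dots,T_n)$, and satisfy $\mathrm E(\epsilon_i^4)\le M$ for a constant $M<\infty$ not depending on $n$; 3. there is a constant $c_0>0$ such that, for all large $n$, $\max\big\{\frac1n\sum_i\sum_{k\ne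 e(i)}R_{ik}^2,\ \frac1n\sum_i(r_i-\bar r_n)^2\big\}>c_0$; 4. $\frac1n\sum_i|N_i|^2=o(\sqrt n)$, $\frac1n\sum_i|N_i|^3=o(n)$ and $\frac1n\sum_{i,j}(\Lambda^3)_{ij}=o(n)$. Then, as $n\to\infty$, $X^{\mathrm T}X$ is invertible with probability tending to one, and $$\sigma_{\tau,n}^{-1}\sqrt n(\hat\tau-\tau)\xrightarrow{d}\mathcal N(0,1),\qquad \sigma_{\gamma,n}^{-1}\sqrt n(\hat\gamma-\gamma)\xrightarrow{d}\mathcal N(0,1),$$ where $\sigma_{\tau,n}^2=4\sigma_\epsilon^2(\bar r_n^2/b_n+1)$ and $\sigma_{\gamma,n}^2=4\sigma_\epsilon^2/b_n$. -/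

import Mathlib

open MeasureTheory ProbabilityTheory Filter Topology Asymptotics
open scoped Matrix

noncomputable section

/-- An ego-clustering of the units `Fin n` of the network `G` into `K` ego-clusters. Cluster `k`
is the fibre of `clusterOf` over `k`; it contains its focal unit `ego k`, and each of its other
members (its alters) is a neighbour of that focal unit. -/
structure EgoClustering {n : ℕ} (G : SimpleGraph (Fin n)) (K : ℕ) where
  /-- the index `e(i)` of the cluster of unit `i` -/
  clusterOf : Fin n → Fin K
  /-- the ego of cluster `k` -/
  ego : Fin K → Fin n
  clusterOf_ego : ∀ k, clusterOf (ego k) = k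
  eq_or_adj_ego : ∀ i, i = ego (clusterOf i) ∨ G.Adj (ego (clusterOf i)) i

namespace EgoClustering

variable {n K : ℕ} {G : SimpleGraph (Fin n)} (E : EgoClustering G K)

/-- The set `E_k` of members of cluster `k`. -/
def cluster (k : Fin K) : Finset (Fin n) :=
  Finset.univ.filter fun i => E.clusterOf i = k

/-- The size of a largest cluster, `max_k |E_k|`. -/
def maxClusterSize : ℕ :=
  Finset.univ.sup fun k => (E.cluster k).card

open Classical in
/-- The interference matrix `R_{ik} = |𝒩_i ∩ E_k| / D_i`. -/
def interference : Matrix (Fin n) (Fin K) ℝ :=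
  Matrix.of fun i k => ((G.neighborFinset i ∩ E.cluster k).card : ℝ) / (G.degree i : ℝ)

/-- The loss rate `r_i = 1 - R_{i e(i)}`. -/
def lossRate (i : Fin n) : ℝ :=
  1 - E.interference i (E.clusterOf i)

/-- The average loss rate. -/
def avgLossRate : ℝ :=
  (∑ i, E.lossRate i) / (n : ℝ)

/-- `n⁻¹ ∑_i ∑_{k ≠ e(i)} R_{ik}²`. -/
def spread : ℝ :=
  (∑ i, ∑ k ∈ Finset.univ.erase (E.clusterOf i), E.interference i k ^ 2) / (n : ℝ)

/-- `n⁻¹ ∑_i (r_i - r̄_n)²`. -/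
def lossVariability : ℝ :=
  (∑ i, (E.lossRate i - E.avgLossRate) ^ 2) / (n : ℝ)

/-- `b_n`, the sum of the two preceding quantities. -/
def bCoeff : ℝ :=
  E.spread + E.lossVariability

open Classical in
/-- `𝒦_i`: the clusters that meet the closed neighbourhood `𝒩_i ∪ {i}` of unit `i`. -/
def reach (i : Fin n) : Finset (Fin K) :=
  Finset.univ.filter fun k => (insert i (G.neighborFinset i) ∩ E.cluster k).Nonempty

/-- The adjacency matrix `Λ` of the dependency graph: `Λ_{ij} = 1` if `𝒦_i ∩ 𝒦_j` is nonempty,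
and `Λ_{ij} = 0` otherwise. -/
def depMatrix : Matrix (Fin n) (Fin n) ℝ :=
  Matrix.of fun i j => if (E.reach i ∩ E.reach j).Nonempty then 1 else 0

/-- The dependence set `N_i = {j : Λ_{ij} = 1}`. -/
def depSet (i : Fin n) : Finset (Fin n) :=
  Finset.univ.filter fun j => (E.reach i ∩ E.reach j).Nonempty

/-- The treatments of the units, when every unit receives the treatment of its cluster. -/
def unitTreatment (S : Fin K → ℝ) (i : Fin n) : ℝ :=
  S (E.clusterOf i)

end EgoClustering

open Classical in
/-- The fraction `ρ_i = ∑_j A_{ij} T_j / D_i` of treated neighbours of unit `i`. -/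
def treatedFraction {n : ℕ} (G : SimpleGraph (Fin n)) (T : Fin n → ℝ) (i : Fin n) : ℝ :=
  (∑ j, G.adjMatrix ℝ i j * T j) / (G.degree i : ℝ)

/-- The outcomes `Y_i = α + β T_i + γ ρ_i + ε_i`. -/
def outcome {n : ℕ} (G : SimpleGraph (Fin n)) (α β γ : ℝ) (T ε : Fin n → ℝ) (i : Fin n) : ℝ :=
  α + β * T i + γ * treatedFraction G T i + ε i

/-- The design matrix with the columns `1_n`, `T` and `ρ`. -/
def designMatrix {n : ℕ} (G : SimpleGraph (Fin n)) (T : Fin n → ℝ) : Matrix (Fin n) (Fin 3) ℝ :=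
  Matrix.of fun i => ![1, T i, treatedFraction G T i]

/-- The ordinary least squares estimator `(α̂, β̂, γ̂) = (XᵀX)⁻¹ Xᵀ Y`. -/
def olsEstimator {n : ℕ} (G : SimpleGraph (Fin n)) (T Y : Fin n → ℝ) : Fin 3 → ℝ :=
  ((designMatrix G T)ᵀ * designMatrix G T)⁻¹ *ᵥ ((designMatrix G T)ᵀ *ᵥ Y)

/-- The estimator `γ̂` of the spillover parameter `γ`. -/
def gammaHat {n : ℕ} (G : SimpleGraph (Fin n)) (T Y : Fin n → ℝ) : ℝ :=
  olsEstimator G T Y 2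

/-- The estimator `τ̂ = β̂ + γ̂` of the global treatment parameter `τ = β + γ`. -/
def tauHat {n : ℕ} (G : SimpleGraph (Fin n)) (T Y : Fin n → ℝ) : ℝ :=
  olsEstimator G T Y 1 + olsEstimator G T Y 2

/-- The law Bernoulli(1/2) on `{0, 1} ⊆ ℝ`. -/
def fairCoin : Measure ℝ :=
  bernoulliMeasure 1 0 ⟨1 / 2, by norm_num, by norm_num⟩

/-- Ego-cluster randomization: the cluster treatments `S_k` are i.i.d. Bernoulli(1/2). -/
structure IsEgoRandomization {K : ℕ} {Ω : Type*} [MeasurableSpace Ω] (S : Fin K → Ω → ℝ)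
    (P : Measure Ω) : Prop where
  indep : iIndepFun S P
  law : ∀ k, HasLaw (S k) fairCoin P

/-- The errors `ε_i` are i.i.d. with mean `0` and variance `σ²`. -/
structure IsIIDError {n : ℕ} {Ω : Type*} [MeasurableSpace Ω] (ε : Fin n → Ω → ℝ) (σ : ℝ)
    (P : Measure Ω) : Prop where
  indep : iIndepFun ε P
  ident : ∀ i j, IdentDistrib (ε i) (ε j) P P
  memLp : ∀ i, MemLp (ε i) 2 P
  mean : ∀ i, ∫ ω, ε i ω ∂P = 0
  variance : ∀ i, Var[ε i; P] = σ ^ 2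

end

/-! Where `XᵀX` is invertible, `l ⬝ᵥ (α̂, β̂, γ̂)` misses its target by exactly `∑ i, w i * ε i`,
and the weights `w = olsWeight G l T` depend on the treatments alone. Since the errors are
independent of `T`, the weights may be frozen and a Lindeberg-type central limit theorem applied to
the errors only. Normality thus needs two facts, both with probability tending to one: `n * ∑ i, w i
^ 2` is close to a deterministic value, and `√n * max |w i|` is small.

Both follow from concentration of the normalized Gram matrix `n⁻¹ XᵀX`. Each row of `X` is affine in
the independent cluster treatments and involves only the clusters in `reach i`, so the summands for
`i` and `j` are uncorrelated unless `j ∈ depSet i`. The variance of each entry is then at most `2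
n⁻² ∑ |N_i|`, which vanishes by the second-moment assumption on `|N_i|`, and Chebyshev applies
(`IsEgoRandomization.measure_sampleGram_sub_le`). The expectation is `populationGram r̄ b`, with
determinant `b / 16`. Because `r̄` lies in `[0, 1]` and `b` in `[c₀, 1]`, these matrices stay in a
compact set of invertible ones, so closeness of Gram matrices passes uniformly to their inverses
(`exists_inv_near_populationGram`).

The quadratic form of the inverse at `(0, 1, 1)` and `(0, 0, 1)` gives the two asymptotic variances.
The central limit theorem `tendstoInDistribution_of_random_weights` is proved with characteristic
functions, with explicit errors so that it is uniform over the frozen weights. -/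

/-! ### Quantitative characteristic function estimates. -/

theorem norm_exp_mul_I_sub_taylor_two_le (x : ℝ) :
    ‖Complex.exp (x * Complex.I) - (1 + x * Complex.I - (x : ℂ) ^ 2 / 2)‖ ≤ 4 * |x| ^ 3 := by
  have hn : ‖(x : ℂ) * Complex.I‖ = |x| := by simp
  rcases le_total |x| 1 with hx | hx
  · have h := Complex.exp_bound (x := x * Complex.I) (by rwa [hn]) (n := 3) (by norm_num)
    rw [hn] at h
    simp only [Finset.sum_range_succ, Finset.range_zero, Finset.sum_empty] at h
    have e : (0 : ℂ) + (x * Complex.I) ^ 0 / (Nat.factorial 0 : ℕ)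
        + (x * Complex.I) ^ 1 / (Nat.factorial 1 : ℕ) + (x * Complex.I) ^ 2 / (Nat.factorial 2 : ℕ)
        = 1 + x * Complex.I - (x : ℂ) ^ 2 / 2 := by
      simp [Nat.factorial, mul_pow]
      ring
    rw [e] at h
    refine h.trans ?_
    rw [mul_comm]
    gcongr
    norm_num [Nat.factorial]
  -- For `|x| ≥ 1` every term is at most a multiple of `|x| ^ 3`; the coefficients add up to `1 + 1
  -- + 1 + 1/2 ≤ 4`.
  · have h1 : ‖Complex.exp (x * Complex.I)‖ = 1 := Complex.norm_exp_ofReal_mul_I x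
    have h2 : ‖(1 + x * Complex.I - (x : ℂ) ^ 2 / 2)‖ ≤ 1 + |x| + |x| ^ 2 / 2 := by
      refine (norm_sub_le _ _).trans (add_le_add ((norm_add_le _ _).trans ?_) ?_)
      · simp
      · simp
    refine (norm_sub_le _ _).trans ?_
    have h3 : |x| ≤ |x| ^ 3 := by nlinarith [sq_nonneg |x|]
    have h4 : |x| ^ 2 ≤ |x| ^ 3 := by nlinarith [sq_nonneg |x|]
    linarith

/-- Both functions are compared with `1 - σ² t² / 2`: the first by Taylor expansion, the third
absolute moment being at most `1 + M`, the second by `|exp (-u) - (1 - u)| ≤ u²` for `u ≥ 0`. The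
bound depends on the law only through `σ` and `M`, hence is uniform in `n`. -/
theorem norm_charFun_sub_exp_le {μ : Measure ℝ} [IsProbabilityMeasure μ] {σ M : ℝ}
    (hint : Integrable (fun x : ℝ => x ^ 4) μ) (hmean : ∫ x, x ∂μ = 0)
    (hvar : ∫ x, x ^ 2 ∂μ = σ ^ 2) (hM : ∫ x, x ^ 4 ∂μ ≤ M) (t : ℝ) :
    ‖charFun μ t - Complex.exp ((-(σ ^ 2 * t ^ 2 / 2) : ℝ))‖
      ≤ 4 * (1 + M) * |t| ^ 3 + σ ^ 4 * t ^ 4 / 4 := by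
  have hb : Integrable (fun x : ℝ => 1 + x ^ 4) μ := (integrable_const 1).add hint
  have h1 : Integrable (fun x : ℝ => x) μ := by
    refine hb.mono' (by fun_prop) (ae_of_all _ fun x => ?_)
    rw [Real.norm_eq_abs, abs_le]
    constructor <;> nlinarith [sq_nonneg (x ^ 2 - 1), sq_nonneg (x - 1), sq_nonneg (x + 1)]
  have h2 : Integrable (fun x : ℝ => x ^ 2) μ := by
    refine hb.mono' (by fun_prop) (ae_of_all _ fun x => ?_)
    rw [Real.norm_eq_abs, abs_of_nonneg (sq_nonneg x)]
    nlinarith [sq_nonneg (x ^ 2 - 1)]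
  have hc : ∀ x : ℝ, |x| ^ 3 ≤ 1 + x ^ 4 := fun x => by
    have : x ^ 4 = |x| ^ 4 := by rw [← abs_pow, abs_of_nonneg (by positivity)]
    rw [this]
    nlinarith [abs_nonneg x, sq_nonneg (|x| ^ 2 - |x|), sq_nonneg (|x| ^ 2 - 1),
      sq_nonneg (|x| - 1)]
  have hexp : Integrable (fun x : ℝ => Complex.exp (t * x * Complex.I)) μ := by
    refine (integrable_const (1 : ℝ)).mono' (by fun_prop) (ae_of_all _ fun x => ?_)
    rw [← Complex.ofReal_mul, Complex.norm_exp_ofReal_mul_I]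
  have hq : ∀ x : ℝ, 1 + ((t * x : ℝ) : ℂ) * Complex.I - ((t * x : ℝ) : ℂ) ^ 2 / 2
      = ((1 - t ^ 2 / 2 * x ^ 2 : ℝ) : ℂ) + ((t * x : ℝ) : ℂ) * Complex.I := fun x => by
    push_cast
    ring
  have hr : Integrable (fun x : ℝ => 1 - t ^ 2 / 2 * x ^ 2) μ :=
    (integrable_const _).sub (h2.const_mul _)
  have hr' : Integrable (fun x : ℝ => ((1 - t ^ 2 / 2 * x ^ 2 : ℝ) : ℂ)) μ := hr.ofReal
  have hi : Integrable (fun x : ℝ => ((t * x : ℝ) : ℂ) * Complex.I) μ :=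
    (h1.const_mul t).ofReal.mul_const _
  have hpol : Integrable (fun x : ℝ =>
      (1 + ((t * x : ℝ) : ℂ) * Complex.I - ((t * x : ℝ) : ℂ) ^ 2 / 2)) μ := by
    simp_rw [hq]
    exact hr'.add hi
  have hpolval : ∫ x, (1 + ((t * x : ℝ) : ℂ) * Complex.I - ((t * x : ℝ) : ℂ) ^ 2 / 2) ∂μ
      = ((1 - σ ^ 2 * t ^ 2 / 2 : ℝ) : ℂ) := by
    simp_rw [hq]
    rw [integral_add hr' hi, integral_mul_const, integral_complex_ofReal, integral_complex_ofReal,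
      integral_sub (integrable_const _) (h2.const_mul _), integral_const_mul, integral_const_mul,
      hvar, hmean]
    simp
    ring
  have hA : ‖charFun μ t - ((1 - σ ^ 2 * t ^ 2 / 2 : ℝ) : ℂ)‖ ≤ 4 * (1 + M) * |t| ^ 3 := by
    rw [charFun_apply_real, ← hpolval, ← integral_sub hexp hpol]
    refine (norm_integral_le_of_norm_le (hb.const_mul (4 * |t| ^ 3))
      (ae_of_all _ fun x => ?_)).trans ?_
    · have := norm_exp_mul_I_sub_taylor_two_le (t * x)
      rw [abs_mul, mul_pow] at this
      rw [← Complex.ofReal_mul]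
      refine this.trans ?_
      rw [← mul_assoc]
      gcongr
      exact hc x
    · rw [integral_const_mul, integral_add (integrable_const _) hint]
      simp only [integral_const, probReal_univ, smul_eq_mul, mul_one]
      rw [show 4 * (1 + M) * |t| ^ 3 = 4 * |t| ^ 3 * (1 + M) by ring]
      gcongr
  have hB : ‖((1 - σ ^ 2 * t ^ 2 / 2 : ℝ) : ℂ) - Complex.exp ((-(σ ^ 2 * t ^ 2 / 2) : ℝ))‖
      ≤ σ ^ 4 * t ^ 4 / 4 := by
    set u := σ ^ 2 * t ^ 2 / 2 with hu
    have hu0 : 0 ≤ u := by positivity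
    have : σ ^ 4 * t ^ 4 / 4 = u ^ 2 := by rw [hu]; ring
    rw [this, ← Complex.ofReal_exp, ← Complex.ofReal_sub, Complex.norm_real, Real.norm_eq_abs,
      abs_sub_comm]
    rcases le_total u 1 with h | h
    · have := Real.abs_exp_sub_one_sub_id_le (x := -u) (by rwa [abs_neg, abs_of_nonneg hu0])
      rw [show Real.exp (-u) - (1 - u) = Real.exp (-u) - 1 - -u by ring]
      simpa using this
    · have h5 := Real.one_sub_le_exp_neg u
      have h6 : Real.exp (-u) ≤ 1 := Real.exp_le_one_iff.2 (by linarith)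
      rw [abs_of_nonneg (by linarith)]
      nlinarith
  calc _ = ‖(charFun μ t - ((1 - σ ^ 2 * t ^ 2 / 2 : ℝ) : ℂ))
        + (((1 - σ ^ 2 * t ^ 2 / 2 : ℝ) : ℂ) - Complex.exp ((-(σ ^ 2 * t ^ 2 / 2) : ℝ)))‖ := by
        congr 1; ring
    _ ≤ _ := (norm_add_le _ _).trans (add_le_add hA hB)

/-- Telescoping: exchanging one factor at a time costs at most the difference of the two factors, as
all the others lie in the unit disc. -/
theorem norm_prod_sub_prod_le {ι : Type*} (s : Finset ι) (f g : ι → ℂ)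
    (hf : ∀ i ∈ s, ‖f i‖ ≤ 1) (hg : ∀ i ∈ s, ‖g i‖ ≤ 1) :
    ‖∏ i ∈ s, f i - ∏ i ∈ s, g i‖ ≤ ∑ i ∈ s, ‖f i - g i‖ := by
  classical
  induction s using Finset.induction_on with
  | empty => simp
  | insert a s ha ih =>
    rw [Finset.prod_insert ha, Finset.prod_insert ha, Finset.sum_insert ha]
    have h1 := ih (fun i hi => hf i (Finset.mem_insert_of_mem hi))
      (fun i hi => hg i (Finset.mem_insert_of_mem hi))
    have h2 : ‖∏ i ∈ s, f i‖ ≤ 1 := by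
      rw [norm_prod]
      exact Finset.prod_le_one (fun i _ => norm_nonneg _)
        fun i hi => hf i (Finset.mem_insert_of_mem hi)
    have h3 : ‖g a‖ ≤ 1 := hg a (Finset.mem_insert_self _ _)
    calc ‖f a * ∏ i ∈ s, f i - g a * ∏ i ∈ s, g i‖
        = ‖(f a - g a) * ∏ i ∈ s, f i + g a * (∏ i ∈ s, f i - ∏ i ∈ s, g i)‖ := by
          congr 1; ring
      _ ≤ ‖f a - g a‖ * ‖∏ i ∈ s, f i‖ + ‖g a‖ * ‖∏ i ∈ s, f i - ∏ i ∈ s, g i‖ := by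
          refine (norm_add_le _ _).trans ?_
          rw [norm_mul, norm_mul]
      _ ≤ ‖f a - g a‖ * 1 + 1 * ∑ i ∈ s, ‖f i - g i‖ := by gcongr
      _ = _ := by ring

/-- The errors of third and fourth order in `a i` each release a power of the maximal weight `κ`,
leaving `∑ a i ^ 2`. Bounded total variance and small weights therefore suffice for the Gaussian
limit. -/
theorem norm_prod_charFun_sub_exp_le {ι : Type*} [Fintype ι] {μ : Measure ℝ}
    [IsProbabilityMeasure μ] {σ M κ : ℝ}
    (hint : Integrable (fun x : ℝ => x ^ 4) μ) (hmean : ∫ x, x ∂μ = 0)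
    (hvar : ∫ x, x ^ 2 ∂μ = σ ^ 2) (hM : ∫ x, x ^ 4 ∂μ ≤ M)
    (a : ι → ℝ) (ha : ∀ i, |a i| ≤ κ) :
    ‖∏ i, charFun μ (a i) - Complex.exp ((-(σ ^ 2 * (∑ i, a i ^ 2) / 2) : ℝ))‖
      ≤ (4 * (1 + M) * κ + σ ^ 4 * κ ^ 2 / 4) * ∑ i, a i ^ 2 := by
  have hM0 : 0 ≤ M := le_trans (integral_nonneg fun x => by positivity) hM
  have e : Complex.exp ((-(σ ^ 2 * (∑ i, a i ^ 2) / 2) : ℝ))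
      = ∏ i, Complex.exp ((-(σ ^ 2 * a i ^ 2 / 2) : ℝ)) := by
    rw [← Complex.exp_sum, ← Complex.ofReal_sum, Finset.mul_sum, Finset.sum_div,
      Finset.sum_neg_distrib]
  rw [e]
  refine (norm_prod_sub_prod_le _ _ _ (fun i _ => norm_charFun_le_one _) fun i _ => ?_).trans ?_
  · rw [← Complex.ofReal_exp, Complex.norm_real, Real.norm_eq_abs, abs_of_pos (Real.exp_pos _)]
    exact Real.exp_le_one_iff.2 (neg_nonpos.2 (by positivity))
  · rw [Finset.mul_sum]
    refine Finset.sum_le_sum fun i _ => (norm_charFun_sub_exp_le hint hmean hvar hM _).trans ?_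
    have h2 : a i ^ 2 = |a i| ^ 2 := (sq_abs _).symm
    have h4 : a i ^ 4 = |a i| ^ 4 := by rw [← abs_pow, abs_of_nonneg (by positivity)]
    rw [h2, h4, add_mul]
    have h0 := abs_nonneg (a i)
    refine add_le_add ?_ ?_
    · calc 4 * (1 + M) * |a i| ^ 3 = 4 * (1 + M) * |a i| * |a i| ^ 2 := by ring
        _ ≤ _ := by gcongr; exact ha i
    · calc σ ^ 4 * |a i| ^ 4 / 4 = σ ^ 4 * |a i| ^ 2 / 4 * |a i| ^ 2 := by ring
        _ ≤ _ := by gcongr; exact ha i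

/-! ### Freezing an independent random vector, and the central limit theorem with random weights. -/

theorem ProbabilityTheory.IndepFun.charFun_map_eq_integral {Ω 𝓧 𝓨 : Type*} [MeasurableSpace Ω]
    [MeasurableSpace 𝓧] [MeasurableSpace 𝓨] {P : Measure Ω} [IsProbabilityMeasure P]
    {X : Ω → 𝓧} {Y : Ω → 𝓨} (hX : AEMeasurable X P) (hY : AEMeasurable Y P)
    (hXY : IndepFun X Y P) {F : 𝓧 → 𝓨 → ℝ} (hF : Measurable (Function.uncurry F)) (t : ℝ) :
    charFun (P.map fun ω => F (X ω) (Y ω)) t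
      = ∫ x, charFun ((P.map Y).map (F x)) t ∂(P.map X) := by
  have := Measure.isProbabilityMeasure_map hX
  have := Measure.isProbabilityMeasure_map hY
  have hm : Measurable fun p : 𝓧 × 𝓨 => Complex.exp (t * Function.uncurry F p * Complex.I) := by
    fun_prop
  have hint : Integrable (fun p : 𝓧 × 𝓨 => Complex.exp (t * Function.uncurry F p * Complex.I))
      ((P.map X).prod (P.map Y)) := by
    refine (integrable_const (1 : ℝ)).mono' hm.aestronglyMeasurable (ae_of_all _ fun p => ?_)
    rw [← Complex.ofReal_mul, Complex.norm_exp_ofReal_mul_I]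
  have e : (P.map fun ω => F (X ω) (Y ω))
      = ((P.map X).prod (P.map Y)).map (Function.uncurry F) := by
    rw [← (indepFun_iff_map_prod_eq_prod_map_map hX hY).1 hXY,
      AEMeasurable.map_map_of_aemeasurable hF.aemeasurable (hX.prodMk hY)]
    rfl
  rw [e, charFun_apply_real, integral_map hF.aemeasurable (by fun_prop), integral_prod _ hint]
  refine integral_congr_ae (ae_of_all _ fun x => ?_)
  have hFx : Measurable (F x) := hF.comp measurable_prodMk_left
  simp only [Function.uncurry]
  rw [charFun_apply_real, integral_map hFx.aemeasurable (by fun_prop)]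

/-- Integrate over the frozen value of `X`: outside `A` two points of the closed unit disc are still
at distance at most `2`. -/
theorem ProbabilityTheory.IndepFun.norm_charFun_map_sub_le {Ω 𝓧 𝓨 : Type*} [MeasurableSpace Ω]
    [MeasurableSpace 𝓧] [MeasurableSpace 𝓨] {P : Measure Ω} [IsProbabilityMeasure P]
    {X : Ω → 𝓧} {Y : Ω → 𝓨} (hX : AEMeasurable X P) (hY : AEMeasurable Y P)
    (hXY : IndepFun X Y P) {F : 𝓧 → 𝓨 → ℝ} (hF : Measurable (Function.uncurry F)) {t : ℝ}
    {A : Set 𝓧} (hA : MeasurableSet A) {c : ℂ} (hc : ‖c‖ ≤ 1) {κ : ℝ} (hκ : 0 ≤ κ)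
    (hbound : ∀ x ∈ A, ‖charFun ((P.map Y).map (F x)) t - c‖ ≤ κ) :
    ‖charFun (P.map fun ω => F (X ω) (Y ω)) t - c‖ ≤ κ + 2 * P.real {ω | X ω ∉ A} := by
  have := Measure.isProbabilityMeasure_map hX
  have := Measure.isProbabilityMeasure_map hY
  have hnorm : ∀ x, ‖charFun ((P.map Y).map (F x)) t‖ ≤ 1 := fun x => by
    have hFx : Measurable (F x) := hF.comp measurable_prodMk_left
    have := Measure.isProbabilityMeasure_map (μ := P.map Y) hFx.aemeasurable
    exact norm_charFun_le_one _
  have hm : StronglyMeasurable fun x => charFun ((P.map Y).map (F x)) t := by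
    have hm' : Measurable fun p : 𝓧 × 𝓨 =>
      Complex.exp (t * Function.uncurry F p * Complex.I) := by fun_prop
    have := hm'.stronglyMeasurable.integral_prod_right' (ν := P.map Y)
    convert! this using 1
    funext x
    have hFx : Measurable (F x) := hF.comp measurable_prodMk_left
    rw [charFun_apply_real, integral_map hFx.aemeasurable (by fun_prop)]
    rfl
  have hi : Integrable (fun x => charFun ((P.map Y).map (F x)) t) (P.map X) :=
    (integrable_const (1 : ℝ)).mono' hm.aestronglyMeasurable (ae_of_all _ hnorm)
  have hc' : c = ∫ _, c ∂(P.map X) := by simp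
  rw [hXY.charFun_map_eq_integral hX hY hF, hc', ← integral_sub hi (integrable_const _)]
  have hig : Integrable (fun x => κ + Aᶜ.indicator (fun _ => (2 : ℝ)) x) (P.map X) :=
    (integrable_const _).add ((integrable_const _).indicator hA.compl)
  refine (norm_integral_le_of_norm_le hig (ae_of_all _ fun x => ?_)).trans (le_of_eq ?_)
  · by_cases hx : x ∈ A
    · simpa [hx] using hbound x hx
    · rw [Set.indicator_of_mem (by simpa using hx)]
      refine (norm_sub_le _ _).trans ?_
      have := hnorm x
      linarith
  · rw [integral_add (integrable_const _) ((integrable_const _).indicator hA.compl),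
      integral_indicator hA.compl, setIntegral_const, map_measureReal_apply_of_aemeasurable hX
        hA.compl]
    simp
    rw [mul_comm]
    rfl

theorem measurable_sum_mul {ι : Type*} [Fintype ι] (a : ι → ℝ) :
    Measurable fun e : ι → ℝ => ∑ i, a i * e i :=
  Finset.measurable_sum _ fun i _ => measurable_const.mul (measurable_pi_apply i)

theorem charFun_map_linear_combination {ι Ω : Type*} [Fintype ι] [MeasurableSpace Ω]
    {P : Measure Ω} [IsProbabilityMeasure P] {ε : ι → Ω → ℝ} (hm : ∀ i, AEMeasurable (ε i) P)
    (hind : iIndepFun ε P) (a : ι → ℝ) (t : ℝ) :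
    charFun ((P.map fun ω i => ε i ω).map fun e => ∑ i, a i * e i) t
      = ∏ i, charFun (P.map (ε i)) (t * a i) := by
  have h1 : iIndepFun (fun i ω => a i * ε i ω) P :=
    hind.comp (fun i x => a i * x) fun i => by fun_prop
  have h2 : ∀ i, AEMeasurable (fun ω => a i * ε i ω) P := fun i => (hm i).const_mul _
  rw [AEMeasurable.map_map_of_aemeasurable
    (measurable_sum_mul a).aemeasurable
    (by fun_prop)]
  have := h1.charFun_map_fun_sum_eq_prod h2
  simp only [Function.comp_def]
  rw [this, Finset.prod_apply]
  refine Finset.prod_congr rfl fun i _ => ?_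
  rw [charFun_map_mul_comp (hm i), mul_comm]

/-- A central limit theorem for linear combinations of i.i.d. errors whose weights depend on an
independent random vector. -/
theorem tendstoInDistribution_of_random_weights {Ω : ℕ → Type*} [∀ n, MeasurableSpace (Ω n)]
    {P : (n : ℕ) → Measure (Ω n)} [∀ n, IsProbabilityMeasure (P n)]
    {ε : (n : ℕ) → Fin n → Ω n → ℝ} {T : (n : ℕ) → Ω n → Fin n → ℝ} {σ M : ℝ} (hσ : 0 < σ)
    (h_err : ∀ n, IsIIDError (ε n) σ (P n)) (hT : ∀ n, AEMeasurable (T n) (P n))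
    (h_indep : ∀ n, IndepFun (fun ω i => ε n i ω) (T n) (P n))
    (h_int : ∀ n i, Integrable (fun ω => ε n i ω ^ 4) (P n))
    (h_four : ∀ n i, ∫ ω, ε n i ω ^ 4 ∂(P n) ≤ M)
    {F : (n : ℕ) → (Fin n → ℝ) → (Fin n → ℝ) → ℝ}
    (hF : ∀ n, Measurable (Function.uncurry (F n)))
    (a : (n : ℕ) → (Fin n → ℝ) → Fin n → ℝ)
    (hgood : ∀ η > 0, ∃ A : (n : ℕ) → Set (Fin n → ℝ), (∀ n, MeasurableSet (A n)) ∧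
      Tendsto (fun n => P n {ω | T n ω ∉ A n}) atTop (𝓝 0) ∧
      ∀ᶠ n in atTop, ∀ x ∈ A n, (∀ e, F n x e = ∑ i, a n x i * e i) ∧
        |∑ i, a n x i ^ 2 - (σ ^ 2)⁻¹| ≤ η ∧ ∀ i, |a n x i| ≤ η) :
    TendstoInDistribution (fun n ω => F n (T n ω) fun i => ε n i ω) atTop (id : ℝ → ℝ) P
      (gaussianReal 0 1) := by
  have hεm : ∀ n i, AEMeasurable (ε n i) (P n) := fun n i =>
    ((h_err n).memLp i).aestronglyMeasurable.aemeasurable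
  have hεv : ∀ n, AEMeasurable (fun ω i => ε n i ω) (P n) := fun n =>
    aemeasurable_pi_lambda _ (hεm n)
  have hFm : ∀ n, AEMeasurable (fun ω => F n (T n ω) fun i => ε n i ω) (P n) := fun n =>
    (hF n).comp_aemeasurable ((hT n).prodMk (hεv n))
  refine ⟨hFm, by fun_prop, ProbabilityMeasure.tendsto_iff_tendsto_charFun.2 fun t => ?_⟩
  simp only [ProbabilityMeasure.coe_mk, Measure.map_id, charFun_gaussianReal]
  set c : ℂ := Complex.exp ((-(t ^ 2 / 2) : ℝ)) with hcdef
  have hc1 : ‖c‖ ≤ 1 := by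
    rw [hcdef, ← Complex.ofReal_exp, Complex.norm_real, Real.norm_eq_abs,
      abs_of_pos (Real.exp_pos _)]
    exact Real.exp_le_one_iff.2 (neg_nonpos.2 (by positivity))
  have hce : Complex.exp (t * (0 : ℝ) * Complex.I - ((1 : NNReal) : ℂ) * t ^ 2 / 2) = c := by
    rw [hcdef]
    congr 1
    push_cast
    simp
  rw [hce]
  -- Total error for weights `t * a i` bounded by `|t| η` with `∑ a i ^ 2 ≤ (σ²)⁻¹ + η`; the last
  -- summand pays for replacing `σ² ∑ a i ^ 2` by `1` in the Gaussian exponent.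
  let k : ℝ → ℝ := fun η => (4 * (1 + M) * (|t| * η) + σ ^ 4 * (|t| * η) ^ 2 / 4)
      * (t ^ 2 * ((σ ^ 2)⁻¹ + η)) + σ ^ 2 * t ^ 2 / 2 * η
  have hk : Tendsto k (𝓝[>] 0) (𝓝 0) := by
    have : Continuous k := by fun_prop
    have h0 : k 0 = 0 := by simp [k]
    simpa [h0] using (this.tendsto 0).mono_left (nhdsWithin_le_nhds (s := Set.Ioi 0))
  rw [Metric.tendsto_atTop']
  intro δ hδ
  -- The bad event enters with factor `2`, so probability below `δ / 4` fills the other half of `δ`.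
  obtain ⟨η, hη0, hηk⟩ : ∃ η > 0, k η < δ / 2 := by
    have h1 : ∀ᶠ η in 𝓝[>] (0 : ℝ), k η < δ / 2 := hk.eventually_lt_const (by positivity)
    obtain ⟨η, h, h'⟩ := (h1.and self_mem_nhdsWithin).exists
    exact ⟨η, h', h⟩
  obtain ⟨A, hAm, hA0, hA⟩ := hgood η hη0
  have hreal : Tendsto (fun n => (P n).real {ω | T n ω ∉ A n}) atTop (𝓝 0) := by
    simpa [measureReal_def, Function.comp_def] using
      (ENNReal.tendsto_toReal ENNReal.zero_ne_top).comp hA0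
  have hsmall : ∀ᶠ n in atTop, (P n).real {ω | T n ω ∉ A n} < δ / 4 :=
    hreal.eventually_lt_const (by positivity)
  obtain ⟨N, hN⟩ := eventually_atTop.1 ((hA.and hsmall).and (eventually_gt_atTop 0))
  refine ⟨N, fun n hn => ?_⟩
  obtain ⟨⟨hAn, hsn⟩, hn0⟩ := hN n hn.le
  have i₀ : Fin n := ⟨0, hn0⟩
  have hmeasε := hεm n i₀
  have := Measure.isProbabilityMeasure_map hmeasε
  have hmap : ∀ i, (P n).map (ε n i) = (P n).map (ε n i₀) := fun i =>
    ((h_err n).ident i i₀).map_eq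
  have e4 : Integrable (fun x : ℝ => x ^ 4) ((P n).map (ε n i₀)) := by
    rw [integrable_map_measure (by fun_prop) hmeasε]
    exact h_int n i₀
  have e1 : ∫ x, x ∂((P n).map (ε n i₀)) = 0 := by
    rw [integral_map hmeasε (by fun_prop)]
    exact (h_err n).mean i₀
  have e2 : ∫ x, x ^ 2 ∂((P n).map (ε n i₀)) = σ ^ 2 := by
    rw [integral_map hmeasε (by fun_prop), ← (h_err n).variance i₀,
      variance_of_integral_eq_zero hmeasε ((h_err n).mean i₀)]
  have e3 : ∫ x, x ^ 4 ∂((P n).map (ε n i₀)) ≤ M := by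
    rw [integral_map hmeasε (by fun_prop)]
    exact h_four n i₀
  have hM0 : 0 ≤ M := le_trans (integral_nonneg fun x => by positivity) e3
  have hkη : 0 ≤ k η := by positivity
  have key : ∀ x ∈ A n, ‖charFun (((P n).map fun ω i => ε n i ω).map (F n x)) t - c‖ ≤ k η := by
    intro x hx
    obtain ⟨hFx, hsum, hmax⟩ := hAn x hx
    rw [show F n x = fun e => ∑ i, a n x i * e i from funext hFx,
      charFun_map_linear_combination (hεm n) (h_err n).indep]
    simp_rw [hmap]
    have b1 := norm_prod_charFun_sub_exp_le (κ := |t| * η) e4 e1 e2 e3 (fun i => t * a n x i)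
      (fun i => by rw [abs_mul]; gcongr; exact hmax i)
    simp_rw [mul_pow] at b1
    rw [← Finset.mul_sum] at b1
    set s := ∑ i, a n x i ^ 2 with hs
    have hs0 : 0 ≤ s := Finset.sum_nonneg fun i _ => sq_nonneg _
    have hs1 : s ≤ (σ ^ 2)⁻¹ + η := by linarith [(abs_le.1 hsum).2]
    have b2 : ‖Complex.exp ((-(σ ^ 2 * (t ^ 2 * s) / 2) : ℝ)) - c‖ ≤ σ ^ 2 * t ^ 2 / 2 * η := by
      rw [hcdef, ← Complex.ofReal_exp, ← Complex.ofReal_exp, ← Complex.ofReal_sub,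
        Complex.norm_real, Real.norm_eq_abs]
      -- `u ↦ exp (-u)` is 1-Lipschitz on the nonnegative half-line.
      have lip : ∀ u v : ℝ, 0 ≤ u → 0 ≤ v → |Real.exp (-u) - Real.exp (-v)| ≤ |u - v| := by
        intro u v hu hv
        wlog huv : u ≤ v generalizing u v
        · rw [abs_sub_comm, abs_sub_comm u]
          exact this v u hv hu (le_of_not_ge huv)
        have h1 := Real.one_sub_le_exp_neg (v - u)
        have h2 : Real.exp (-v) = Real.exp (-u) * Real.exp (-(v - u)) := by
          rw [← Real.exp_add]; congr 1; ring
        have h3 : Real.exp (-u) ≤ 1 := Real.exp_le_one_iff.2 (by linarith)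
        have h4 := Real.exp_pos (-u)
        have h5 : Real.exp (-(v - u)) ≤ 1 := Real.exp_le_one_iff.2 (by linarith)
        rw [abs_of_nonneg (by rw [h2]; nlinarith), abs_of_nonpos (by linarith), h2]
        nlinarith
      refine (lip _ _ (by positivity) (by positivity)).trans ?_
      have : σ ^ 2 * (t ^ 2 * s) / 2 - t ^ 2 / 2 = σ ^ 2 * t ^ 2 / 2 * (s - (σ ^ 2)⁻¹) := by
        field_simp
      rw [this, abs_mul, abs_of_nonneg (by positivity : 0 ≤ σ ^ 2 * t ^ 2 / 2)]
      gcongr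
    refine (norm_sub_le_norm_sub_add_norm_sub _ _ _).trans (add_le_add (b1.trans ?_) b2)
    rw [← mul_pow]
    gcongr
  have := (h_indep n).symm.norm_charFun_map_sub_le (hT n) (hεv n) (hF n) (hAm n) hc1 hkη key
  rw [dist_eq_norm]
  linarith

/-! ### The population Gram matrix and its inverse. -/

/-- The limit of the normalized Gram matrix `n⁻¹ XᵀX` when the average loss rate is `r` and the
coefficient `b_n` is `b`. -/
noncomputable def populationGram (r b : ℝ) : Matrix (Fin 3) (Fin 3) ℝ :=
  !![1, 1 / 2, 1 / 2;
     1 / 2, 1 / 2, (2 - r) / 4;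
     1 / 2, (2 - r) / 4, (1 + b + (1 - r) ^ 2) / 4]

/-- Eliminating the constant regressor leaves the covariance block `(1/4) [[1, 1 - r], [1 - r, b +
(1 - r)²]]`, in which `(1 - r)²` cancels. So `b` measures exactly how far `ρ` is from collinear with
`1` and `T`. -/
theorem det_populationGram (r b : ℝ) : (populationGram r b).det = b / 16 := by
  rw [populationGram, Matrix.det_fin_three]
  simp
  ring

theorem inv_populationGram (r b : ℝ) : (populationGram r b)⁻¹
    = (b / 16)⁻¹ • (populationGram r b).adjugate := by
  rw [Matrix.inv_def, det_populationGram, Ring.inverse_eq_inv']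

theorem dotProduct_inv_populationGram_spillover {r b : ℝ} (hb : b ≠ 0) :
    ![0, 0, 1] ⬝ᵥ ((populationGram r b)⁻¹ *ᵥ ![0, 0, 1]) = 4 / b := by
  rw [inv_populationGram, populationGram, Matrix.adjugate_fin_three_of]
  simp [Matrix.mulVec, dotProduct, Fin.sum_univ_three]
  field_simp
  ring

theorem dotProduct_inv_populationGram_total {r b : ℝ} (hb : b ≠ 0) :
    ![0, 1, 1] ⬝ᵥ ((populationGram r b)⁻¹ *ᵥ ![0, 1, 1]) = 4 * (r ^ 2 / b + 1) := by
  rw [inv_populationGram, populationGram, Matrix.adjugate_fin_three_of]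
  simp [Matrix.mulVec, dotProduct, Fin.sum_univ_three]
  field_simp
  ring

theorem continuous_populationGram :
    Continuous fun p : ℝ × ℝ => populationGram p.1 p.2 := by
  refine continuous_matrix fun i j => ?_
  fin_cases i <;> fin_cases j <;> simp [populationGram] <;> fun_prop

/-- Inversion is uniformly continuous near the set of nondegenerate population Gram matrices. -/
theorem exists_inv_near_populationGram (l : Fin 3 → ℝ) {c₀ η : ℝ} (hc₀ : 0 < c₀) (hη : 0 < η) :
    ∃ δ > 0, ∃ C > 0, ∀ r ∈ Set.Icc (0 : ℝ) 1, ∀ b ∈ Set.Icc c₀ 1,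
      ∀ Q : Matrix (Fin 3) (Fin 3) ℝ, (∀ i j, |Q i j - populationGram r b i j| < δ) →
        Q.det ≠ 0 ∧
        |l ⬝ᵥ (Q⁻¹ *ᵥ l) - l ⬝ᵥ ((populationGram r b)⁻¹ *ᵥ l)| ≤ η ∧
        ∀ i j, |Q⁻¹ i j| ≤ C := by
  let pg : ℝ × ℝ → Fin 3 → Fin 3 → ℝ := fun p => populationGram p.1 p.2
  let S : Set (Fin 3 → Fin 3 → ℝ) := pg '' (Set.Icc (0 : ℝ) 1 ×ˢ Set.Icc c₀ 1)
  have hS : IsCompact S :=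
    (isCompact_Icc.prod isCompact_Icc).image continuous_populationGram
  let f : (Fin 3 → Fin 3 → ℝ) → ℝ × ℝ × (Fin 3 → Fin 3 → ℝ) := fun Q =>
    (l ⬝ᵥ ((Matrix.of Q)⁻¹ *ᵥ l), (Matrix.of Q).det, fun i j => (Matrix.of Q)⁻¹ i j)
  have hdet : ∀ Q ∈ S, c₀ / 16 ≤ (Matrix.of Q).det := by
    rintro _ ⟨p, hp, rfl⟩
    change _ ≤ (populationGram p.1 p.2).det
    rw [det_populationGram]
    have := hp.2.1
    linarith
  have hf : ∀ Q ∈ S, ContinuousAt f Q := by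
    intro Q hQ
    have h0 : (Matrix.of Q).det ≠ 0 := by linarith [hdet Q hQ, hc₀] |> fun h => ne_of_gt h
    have hinv : ContinuousAt (fun Q : Fin 3 → Fin 3 → ℝ => (Matrix.of Q)⁻¹) Q := by
      have := continuousAt_matrix_inv (Matrix.of Q) (by
        rw [Ring.inverse_eq_inv']
        exact continuousAt_inv₀ h0)
      exact this
    have hvec : Continuous fun B : Matrix (Fin 3) (Fin 3) ℝ => l ⬝ᵥ (B *ᵥ l) := by fun_prop
    have hd : Continuous fun Q : Fin 3 → Fin 3 → ℝ => (Matrix.of Q).det :=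
      Continuous.matrix_det continuous_id
    exact (hvec.continuousAt.comp hinv).prodMk (hd.continuousAt.prodMk hinv)
  obtain ⟨C, hC⟩ := (hS.image_of_continuousOn
    fun Q hQ => (hf Q hQ).continuousWithinAt).isBounded.exists_norm_le
  -- The three tolerances serve the quadratic form, the determinant (at least `c₀ / 16` on `S`, so
  -- half of it survives) and the entries of the inverse (whence `|C| + 1`).
  have hmin : 0 < min η (min (c₀ / 32) 1) := by positivity
  -- Continuity of `f` at every point of the compact `S` gives one `δ` that also serves matrices `Q`
  -- outside `S`.
  have hu := hS.uniformContinuousAt_of_continuousAt f hf (Metric.dist_mem_uniformity hmin)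
  obtain ⟨δ, hδ, h⟩ := Metric.mem_uniformity_dist.1 hu
  refine ⟨δ, hδ, |C| + 1, by positivity, fun r hr b hb Q hQ => ?_⟩
  have hmem : pg (r, b) ∈ S := ⟨(r, b), ⟨hr, hb⟩, rfl⟩
  have hdist : dist (pg (r, b)) (fun i j => Q i j) < δ := by
    rw [dist_comm, dist_pi_lt_iff hδ]
    intro i
    rw [dist_pi_lt_iff hδ]
    intro j
    exact hQ i j
  have hclose := h hdist hmem
  simp only [Set.mem_ofPred_eq] at hclose
  rw [dist_comm, Prod.dist_eq, Prod.dist_eq, max_lt_iff, max_lt_iff, lt_min_iff, lt_min_iff,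
    lt_min_iff, lt_min_iff, lt_min_iff, lt_min_iff] at hclose
  obtain ⟨⟨h1, -⟩, ⟨-, h2, -⟩, -, -, h3⟩ := hclose
  refine ⟨?_, h1.le, fun i j => ?_⟩
  · have h4 := hdet _ hmem
    have h5 := (abs_lt.1 h2).1
    simp only [f] at h5
    have : 0 < Q.det := by
      change _ < Q.det - _ at h5
      linarith
    exact this.ne'
  · have h6 : ‖f (pg (r, b))‖ ≤ C := hC _ (Set.mem_image_of_mem _ hmem)
    have h7 := (norm_le_pi_norm _ j).trans ((norm_le_pi_norm _ i).trans
      ((norm_snd_le _).trans ((norm_snd_le _).trans h6)))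
    have h8 := (dist_le_pi_dist _ _ j).trans_lt ((dist_le_pi_dist _ _ i).trans_lt h3)
    rw [Real.dist_eq] at h8
    rw [Real.norm_eq_abs] at h7
    have h9 : |Q⁻¹ i j - (populationGram r b)⁻¹ i j| < 1 := h8
    have h10 : |(populationGram r b)⁻¹ i j| ≤ C := h7
    have := abs_sub_abs_le_abs_sub (Q⁻¹ i j) ((populationGram r b)⁻¹ i j)
    linarith [le_abs_self C]

/-! ### Least squares as a weighted sum of the errors. -/

/-- The normalized Gram matrix `n⁻¹ XᵀX`. -/
noncomputable def sampleGram {n : ℕ} (G : SimpleGraph (Fin n)) (T : Fin n → ℝ) : Matrix (Fin 3) (Fin 3) ℝ :=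
  (n : ℝ)⁻¹ • ((designMatrix G T)ᵀ * designMatrix G T)

/-- The weights with which the errors enter the least squares estimator of `l ⬝ᵥ (α, β, γ)`. -/
noncomputable def olsWeight {n : ℕ} (G : SimpleGraph (Fin n)) (l : Fin 3 → ℝ) (T : Fin n → ℝ) : Fin n → ℝ :=
  l ᵥ* (((designMatrix G T)ᵀ * designMatrix G T)⁻¹ * (designMatrix G T)ᵀ)

theorem outcome_eq_mulVec {n : ℕ} (G : SimpleGraph (Fin n)) (α β γ : ℝ) (T e : Fin n → ℝ) :
    outcome G α β γ T e = designMatrix G T *ᵥ ![α, β, γ] + e := by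
  funext i
  simp [outcome, designMatrix]
  ring

theorem dotProduct_olsEstimator_outcome {n : ℕ} (G : SimpleGraph (Fin n)) (l : Fin 3 → ℝ)
    (α β γ : ℝ) (T e : Fin n → ℝ)
    (h : ((designMatrix G T)ᵀ * designMatrix G T).det ≠ 0) :
    l ⬝ᵥ olsEstimator G T (outcome G α β γ T e) - l ⬝ᵥ ![α, β, γ]
      = ∑ i, olsWeight G l T i * e i := by
  have hu : IsUnit ((designMatrix G T)ᵀ * designMatrix G T).det := h.isUnit
  rw [olsEstimator, outcome_eq_mulVec, Matrix.mulVec_add, Matrix.mulVec_add, Matrix.mulVec_mulVec,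
    Matrix.mulVec_mulVec, Matrix.mul_assoc, Matrix.nonsing_inv_mul _ hu, Matrix.one_mulVec, dotProduct_add,
    add_sub_cancel_left, Matrix.mulVec_mulVec, Matrix.dotProduct_mulVec]
  rfl

/-- In `w ⬝ᵥ w` the factor `XᵀX` cancels one of the two inverses. Times `σ²`, this is the variance
of the estimator for frozen treatments. -/
theorem sum_olsWeight_sq {n : ℕ} (G : SimpleGraph (Fin n)) (l : Fin 3 → ℝ) (T : Fin n → ℝ)
    (h : ((designMatrix G T)ᵀ * designMatrix G T).det ≠ 0) :
    ∑ i, olsWeight G l T i ^ 2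
      = l ⬝ᵥ (((designMatrix G T)ᵀ * designMatrix G T)⁻¹ *ᵥ l) := by
  have hu : IsUnit ((designMatrix G T)ᵀ * designMatrix G T).det := h.isUnit
  have e : ∑ i, olsWeight G l T i ^ 2 = olsWeight G l T ⬝ᵥ olsWeight G l T :=
    Finset.sum_congr rfl fun i _ => sq _
  have ht : (((designMatrix G T)ᵀ * designMatrix G T)⁻¹ * (designMatrix G T)ᵀ)ᵀ
      = designMatrix G T * ((designMatrix G T)ᵀ * designMatrix G T)⁻¹ := by
    rw [Matrix.transpose_mul, Matrix.transpose_transpose, Matrix.transpose_nonsing_inv,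
      Matrix.transpose_mul, Matrix.transpose_transpose]
  rw [e]
  nth_rw 2 [olsWeight]
  rw [← Matrix.mulVec_transpose, ht, olsWeight, ← Matrix.dotProduct_mulVec, Matrix.mulVec_mulVec]
  congr 2
  rw [Matrix.mul_assoc, ← Matrix.mul_assoc (designMatrix G T)ᵀ, Matrix.mul_nonsing_inv _ hu,
    Matrix.mul_one]

theorem gram_inv_eq {n : ℕ} (hn : 0 < n) (G : SimpleGraph (Fin n)) (T : Fin n → ℝ)
    (h : (sampleGram G T).det ≠ 0) :
    ((designMatrix G T)ᵀ * designMatrix G T).det ≠ 0 ∧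
      ((designMatrix G T)ᵀ * designMatrix G T)⁻¹ = (n : ℝ)⁻¹ • (sampleGram G T)⁻¹ := by
  have hn' : (n : ℝ) ≠ 0 := by positivity
  have e : (designMatrix G T)ᵀ * designMatrix G T = (n : ℝ) • sampleGram G T := by
    rw [sampleGram, smul_smul, mul_inv_cancel₀ hn', one_smul]
  refine ⟨?_, ?_⟩
  · rw [e, Matrix.det_smul]
    exact mul_ne_zero (pow_ne_zero _ hn') h
  · rw [e]
    have := Matrix.inv_smul' (Units.mk0 (n : ℝ) hn') (A := sampleGram G T) h.isUnit
    simpa [Units.smul_def] using this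

theorem sum_olsWeight_sq_eq_sampleGram {n : ℕ} (hn : 0 < n) (G : SimpleGraph (Fin n))
    (l : Fin 3 → ℝ) (T : Fin n → ℝ) (h : (sampleGram G T).det ≠ 0) :
    ∑ i, olsWeight G l T i ^ 2 = (n : ℝ)⁻¹ * (l ⬝ᵥ ((sampleGram G T)⁻¹ *ᵥ l)) := by
  obtain ⟨h1, h2⟩ := gram_inv_eq hn G T h
  rw [sum_olsWeight_sq G l T h1, h2, Matrix.smul_mulVec, dotProduct_smul, smul_eq_mul]

theorem abs_treatedFraction_le_one {n : ℕ} (G : SimpleGraph (Fin n)) {T : Fin n → ℝ}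
    (hT : ∀ i, |T i| ≤ 1) (i : Fin n) : |treatedFraction G T i| ≤ 1 := by
  classical
  rw [treatedFraction, abs_div, abs_of_nonneg (by positivity : (0 : ℝ) ≤ G.degree i)]
  refine div_le_one_of_le₀ ?_ (by positivity)
  have hd : (G.degree i : ℝ) = ∑ j, G.adjMatrix ℝ i j := by
    rw [← SimpleGraph.card_neighborFinset_eq_degree, SimpleGraph.neighborFinset_eq_filter]
    simp [SimpleGraph.adjMatrix_apply]
  refine (Finset.abs_sum_le_sum_abs _ _).trans ?_
  refine (Finset.sum_le_sum fun j _ => ?_).trans (le_of_eq (hd.symm.trans (by congr!)))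
  rw [abs_mul, SimpleGraph.adjMatrix_apply]
  split_ifs
  · simpa using hT j
  · simp

theorem abs_designMatrix_le_one {n : ℕ} (G : SimpleGraph (Fin n)) {T : Fin n → ℝ}
    (hT : ∀ i, |T i| ≤ 1) (i : Fin n) (j : Fin 3) : |designMatrix G T i j| ≤ 1 := by
  have := abs_treatedFraction_le_one G hT i
  have := hT i
  fin_cases j <;> simp [designMatrix, *]

/-- The regressors are bounded, so no unit has leverage beyond order `1 / n`; multiplied by `√n` the
weights vanish uniformly. The `9` counts the entries of the inverse. -/
theorem abs_olsWeight_le {n : ℕ} (hn : 0 < n) (G : SimpleGraph (Fin n)) {l : Fin 3 → ℝ}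
    {T : Fin n → ℝ} {C : ℝ} (hl : ∀ j, |l j| ≤ 1) (hT : ∀ i, |T i| ≤ 1)
    (h : (sampleGram G T).det ≠ 0) (hC : ∀ i j, |(sampleGram G T)⁻¹ i j| ≤ C) (i : Fin n) :
    |olsWeight G l T i| ≤ (n : ℝ)⁻¹ * (9 * C) := by
  have e : olsWeight G l T i
      = (n : ℝ)⁻¹ * ∑ j, ∑ k, l j * ((sampleGram G T)⁻¹ j k * designMatrix G T i k) := by
    rw [olsWeight, (gram_inv_eq hn G T h).2, Matrix.smul_mul, Matrix.vecMul_smul, Pi.smul_apply,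
      smul_eq_mul]
    congr 1
    simp only [Matrix.vecMul, dotProduct, Matrix.mul_apply, Matrix.transpose_apply, Finset.mul_sum]
  have hC0 : 0 ≤ C := (abs_nonneg _).trans (hC 0 0)
  rw [e, abs_mul, abs_of_nonneg (by positivity : (0 : ℝ) ≤ (n : ℝ)⁻¹)]
  gcongr
  calc _ ≤ ∑ j : Fin 3, ∑ k : Fin 3, C := by
        refine (Finset.abs_sum_le_sum_abs _ _).trans (Finset.sum_le_sum fun j _ =>
          (Finset.abs_sum_le_sum_abs _ _).trans (Finset.sum_le_sum fun k _ => ?_))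
        rw [abs_mul, abs_mul]
        calc _ ≤ 1 * (C * 1) := by
              gcongr
              · exact hl j
              · exact hC j k
              · exact abs_designMatrix_le_one G hT i k
          _ = C := by ring
    _ = 9 * C := by simp; ring

/-! ### Measurability of the estimator. -/

theorem measurable_treatedFraction {n : ℕ} (G : SimpleGraph (Fin n)) (i : Fin n) :
    Measurable fun T : Fin n → ℝ => treatedFraction G T i := by
  unfold treatedFraction
  exact (measurable_sum_mul _).div_const _

theorem measurable_designMatrix {n : ℕ} (G : SimpleGraph (Fin n)) (i : Fin n) (j : Fin 3) :
    Measurable fun T : Fin n → ℝ => designMatrix G T i j := by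
  have := measurable_treatedFraction G i
  fin_cases j <;> simp [designMatrix] <;> fun_prop

theorem measurable_sampleGram {n : ℕ} (G : SimpleGraph (Fin n)) (i j : Fin 3) :
    Measurable fun T : Fin n → ℝ => sampleGram G T i j := by
  simp only [sampleGram, Matrix.smul_apply, Matrix.mul_apply, Matrix.transpose_apply]
  exact measurable_const.mul (Finset.measurable_sum _ fun k _ =>
    (measurable_designMatrix G k i).mul (measurable_designMatrix G k j))

theorem measurable_matrix_det {𝓧 ι : Type*} [MeasurableSpace 𝓧] [Fintype ι] [DecidableEq ι]
    {A : 𝓧 → Matrix ι ι ℝ} (hA : ∀ i j, Measurable fun x => A x i j) :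
    Measurable fun x => (A x).det := by
  simp only [Matrix.det_apply']
  exact Finset.measurable_sum _ fun τ _ =>
    measurable_const.mul (Finset.measurable_prod _ fun i _ => hA _ _)

/-- By Cramer's rule the entries are quotients of polynomials. With `0⁻¹ = 0` the formula also
covers singular matrices, where the inverse is `0`. -/
theorem measurable_matrix_inv {𝓧 ι : Type*} [MeasurableSpace 𝓧] [Fintype ι] [DecidableEq ι]
    {A : 𝓧 → Matrix ι ι ℝ} (hA : ∀ i j, Measurable fun x => A x i j) (i j : ι) :
    Measurable fun x => (A x)⁻¹ i j := by
  simp only [Matrix.inv_def, Ring.inverse_eq_inv', Matrix.smul_apply, smul_eq_mul,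
    Matrix.adjugate_apply]
  refine (measurable_matrix_det hA).inv.mul (measurable_matrix_det fun k m => ?_)
  simp only [Matrix.updateRow_apply]
  split_ifs
  · exact measurable_const
  · exact hA k m

theorem measurable_gram_inv {n : ℕ} (G : SimpleGraph (Fin n)) (i j : Fin 3) :
    Measurable fun T : Fin n → ℝ => ((designMatrix G T)ᵀ * designMatrix G T)⁻¹ i j := by
  refine measurable_matrix_inv (fun i j => ?_) i j
  simp only [Matrix.mul_apply, Matrix.transpose_apply]
  exact Finset.measurable_sum _ fun k _ =>
    (measurable_designMatrix G k i).mul (measurable_designMatrix G k j)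

theorem measurable_olsEstimator_outcome {n : ℕ} (G : SimpleGraph (Fin n)) (α β γ : ℝ) (j : Fin 3) :
    Measurable fun p : (Fin n → ℝ) × (Fin n → ℝ) =>
      olsEstimator G p.1 (outcome G α β γ p.1 p.2) j := by
  have hX : ∀ i j, Measurable fun p : (Fin n → ℝ) × (Fin n → ℝ) => designMatrix G p.1 i j :=
    fun i j => (measurable_designMatrix G i j).comp measurable_fst
  have hY : ∀ i, Measurable fun p : (Fin n → ℝ) × (Fin n → ℝ) => outcome G α β γ p.1 p.2 i := by
    intro i
    have := (measurable_treatedFraction G i).comp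
      (measurable_fst : Measurable (Prod.fst : (Fin n → ℝ) × (Fin n → ℝ) → _))
    simp only [Function.comp_def] at this
    unfold outcome
    fun_prop
  simp only [olsEstimator, Matrix.mulVec, dotProduct, Matrix.transpose_apply]
  exact Finset.measurable_sum _ fun k _ =>
    ((measurable_gram_inv G j k).comp measurable_fst).mul
      (Finset.measurable_sum _ fun i _ => (hX i k).mul (hY i))

/-! ### The interference matrix and the expected Gram matrix. -/

namespace EgoClustering

variable {n K : ℕ} {G : SimpleGraph (Fin n)} (E : EgoClustering G K)

/-- The coefficients of the treatment regressors of unit `i` with respect to the cluster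
treatments. -/
noncomputable def designCoeff (i : Fin n) : Fin 3 → Fin K → ℝ :=
  ![0, Pi.single (E.clusterOf i) 1, E.interference i]

theorem treatedFraction_unitTreatment (s : Fin K → ℝ) (i : Fin n) :
    treatedFraction G (E.unitTreatment s) i = ∑ k, E.interference i k * s k := by
  classical
  have h : ∑ j, G.adjMatrix ℝ i j * E.unitTreatment s j
      = ∑ k, ((G.neighborFinset i ∩ E.cluster k).card : ℝ) * s k := by
    rw [← Finset.sum_fiberwise Finset.univ E.clusterOf]
    refine Finset.sum_congr rfl fun k _ => ?_
    have : ∀ j ∈ Finset.univ.filter fun j => E.clusterOf j = k,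
        G.adjMatrix ℝ i j * E.unitTreatment s j = G.adjMatrix ℝ i j * s k := by
      intro j hj
      rw [unitTreatment, (Finset.mem_filter.1 hj).2]
    rw [Finset.sum_congr rfl this, ← Finset.sum_mul]
    congr 1
    simp only [SimpleGraph.adjMatrix_apply, Finset.sum_boole, cluster,
      SimpleGraph.neighborFinset_eq_filter, ← Finset.filter_and, Finset.filter_filter]
    congr 2
    ext j
    simp [and_comm]
  have h2 : treatedFraction G (E.unitTreatment s) i
      = (∑ j, G.adjMatrix ℝ i j * E.unitTreatment s j) / (G.degree i : ℝ) := by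
    unfold treatedFraction
    congr!
  rw [h2, h, Finset.sum_div]
  refine Finset.sum_congr rfl fun k _ => ?_
  simp only [interference, Matrix.of_apply]
  rw [mul_div_right_comm]

theorem sum_interference {i : Fin n} (hi : ∃ j, G.Adj i j) : ∑ k, E.interference i k = 1 := by
  classical
  have h := E.treatedFraction_unitTreatment (fun _ => 1) i
  simp only [mul_one] at h
  have hd : (G.degree i : ℝ) ≠ 0 := by
    rw [Nat.cast_ne_zero, ← Nat.pos_iff_ne_zero, SimpleGraph.degree_pos_iff_exists_adj]
    exact hi
  have h2 : treatedFraction G (E.unitTreatment fun _ => 1) i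
      = (∑ j, G.adjMatrix ℝ i j * E.unitTreatment (fun _ => 1) j) / (G.degree i : ℝ) := by
    unfold treatedFraction
    congr!
  rw [← h, h2]
  simp only [unitTreatment, mul_one, SimpleGraph.adjMatrix_apply, Finset.sum_boole]
  rw [← SimpleGraph.neighborFinset_eq_filter, SimpleGraph.card_neighborFinset_eq_degree,
    div_self hd]

theorem interference_nonneg (i : Fin n) (k : Fin K) : 0 ≤ E.interference i k := by
  simp only [interference, Matrix.of_apply]
  positivity

theorem interference_le_one {i : Fin n} (hi : ∃ j, G.Adj i j) (k : Fin K) :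
    E.interference i k ≤ 1 := by
  rw [← E.sum_interference hi]
  exact Finset.single_le_sum (fun k _ => E.interference_nonneg i k) (Finset.mem_univ k)

theorem interference_eq_zero {i : Fin n} {k : Fin K} (hk : k ∉ E.reach i) :
    E.interference i k = 0 := by
  classical
  have : ¬ (insert i (G.neighborFinset i) ∩ E.cluster k).Nonempty := by
    intro h
    apply hk
    simp only [reach, Finset.mem_filter, Finset.mem_univ, true_and]
    convert! h
  have h2 : G.neighborFinset i ∩ E.cluster k = ∅ := by
    rw [Finset.not_nonempty_iff_eq_empty] at this
    refine Finset.subset_empty.1 (this ▸ Finset.inter_subset_inter_right ?_)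
    exact Finset.subset_insert _ _
  have h3 : E.interference i k
      = ((G.neighborFinset i ∩ E.cluster k).card : ℝ) / (G.degree i : ℝ) := by
    simp only [interference, Matrix.of_apply]
  simp [h3, h2]

theorem clusterOf_mem_reach (i : Fin n) : E.clusterOf i ∈ E.reach i := by
  simp only [reach, Finset.mem_filter, Finset.mem_univ, true_and]
  exact ⟨i, by simp [cluster]⟩

/-- This locality is what makes `depMatrix` a dependency graph for the rows of the design. -/
theorem designCoeff_eq_zero {i : Fin n} {k : Fin K} (hk : k ∉ E.reach i) (a : Fin 3) :
    E.designCoeff i a k = 0 := by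
  have h : k ≠ E.clusterOf i := fun h => hk (h ▸ E.clusterOf_mem_reach i)
  fin_cases a <;> simp [designCoeff, h, E.interference_eq_zero hk]

theorem designMatrix_unitTreatment (s : Fin K → ℝ) (i : Fin n) (a : Fin 3) :
    designMatrix G (E.unitTreatment s) i a
      = (![1, 0, 0] : Fin 3 → ℝ) a + ∑ k, E.designCoeff i a k * s k := by
  have := E.treatedFraction_unitTreatment s i
  fin_cases a <;> simp [designMatrix, designCoeff, this, Pi.single_apply, unitTreatment]

theorem sum_designCoeff {i : Fin n} (hi : ∃ j, G.Adj i j) (a : Fin 3) :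
    ∑ k, E.designCoeff i a k = (![0, 1, 1] : Fin 3 → ℝ) a := by
  have := E.sum_interference hi
  fin_cases a <;> simp [designCoeff, this]

theorem avgLossRate_mem_Icc (h : ∀ i, ∃ j, G.Adj i j) : E.avgLossRate ∈ Set.Icc (0 : ℝ) 1 := by
  have h0 : ∀ i, 0 ≤ E.lossRate i := fun i => by
    have := E.interference_le_one (h i) (E.clusterOf i)
    rw [lossRate]; linarith
  have h1 : ∀ i, E.lossRate i ≤ 1 := fun i => by
    have := E.interference_nonneg i (E.clusterOf i)
    rw [lossRate]; linarith
  refine ⟨div_nonneg (Finset.sum_nonneg fun i _ => h0 i) (by positivity), ?_⟩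
  refine div_le_one_of_le₀ ((Finset.sum_le_sum fun i _ => h1 i).trans ?_) (by positivity)
  simp

/-- The own-cluster term of row `i` is `(1 - r_i)²`, and its average is the variance of the loss
rates plus the squared mean `(1 - r̄)²`. -/
theorem bCoeff_add_sq (hn : 0 < n) :
    E.bCoeff + (1 - E.avgLossRate) ^ 2 = (∑ i, ∑ k, E.interference i k ^ 2) / (n : ℝ) := by
  have hn' : (n : ℝ) ≠ 0 := by positivity
  have hr : ∑ i, E.lossRate i = n * E.avgLossRate := by
    rw [avgLossRate]; field_simp
  have hs : ∀ i, ∑ k ∈ Finset.univ.erase (E.clusterOf i), E.interference i k ^ 2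
      = ∑ k, E.interference i k ^ 2 - (1 - E.lossRate i) ^ 2 := fun i => by
    rw [← Finset.add_sum_erase _ _ (Finset.mem_univ (E.clusterOf i)), lossRate]
    ring
  have hv : ∑ i, (E.lossRate i - E.avgLossRate) ^ 2
      = ∑ i, (1 - E.lossRate i) ^ 2 - n * (1 - E.avgLossRate) ^ 2 := by
    have : ∀ i, (E.lossRate i - E.avgLossRate) ^ 2 = (1 - E.lossRate i) ^ 2
        + (2 - 2 * E.avgLossRate) * E.lossRate i + (E.avgLossRate ^ 2 - 1) := fun i => by ring
    simp_rw [this]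
    rw [Finset.sum_add_distrib, Finset.sum_add_distrib, ← Finset.mul_sum, hr]
    simp
    ring
  rw [bCoeff, spread, lossVariability, hv]
  simp_rw [hs]
  rw [Finset.sum_sub_distrib]
  field_simp
  ring

/-- Rows of the interference matrix are probability vectors, so their squares sum to at most `1`.
The bound closes the compact parameter range. -/
theorem bCoeff_le_one (h : ∀ i, ∃ j, G.Adj i j) : E.bCoeff ≤ 1 := by
  rcases Nat.eq_zero_or_pos n with rfl | hn
  · simp [bCoeff, spread, lossVariability]
  have h1 : (∑ i, ∑ k, E.interference i k ^ 2) / (n : ℝ) ≤ 1 := by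
    refine div_le_one_of_le₀ ?_ (by positivity)
    calc _ ≤ ∑ i : Fin n, ∑ k, E.interference i k := by
          refine Finset.sum_le_sum fun i _ => Finset.sum_le_sum fun k _ => ?_
          have := E.interference_nonneg i k
          have := E.interference_le_one (h i) k
          nlinarith
      _ = n := by simp [fun i => E.sum_interference (h i)]
  have := E.bCoeff_add_sq hn
  nlinarith [sq_nonneg (1 - E.avgLossRate)]

theorem max_le_bCoeff : max E.spread E.lossVariability ≤ E.bCoeff := by
  have h1 : 0 ≤ E.spread := by unfold spread; positivity
  have h2 : 0 ≤ E.lossVariability := by unfold lossVariability; positivity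
  rw [bCoeff]
  exact max_le (by linarith) (by linarith)

/-- The vector `(1, 1/2, 1/2)` is the mean of a design row and `1/4` the variance of a fair coin, so
each summand is the expected product of two entries of a row. -/
theorem mean_designCoeff (hn : 0 < n) (a b : Fin 3) :
    (n : ℝ)⁻¹ * ∑ i, ((![1, 1 / 2, 1 / 2] : Fin 3 → ℝ) a * (![1, 1 / 2, 1 / 2] : Fin 3 → ℝ) b
        + 1 / 4 * ∑ k, E.designCoeff i a k * E.designCoeff i b k)
      = populationGram E.avgLossRate E.bCoeff a b := by
  have hn' : (n : ℝ) ≠ 0 := by positivity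
  have hr : ∑ i, E.interference i (E.clusterOf i) = n * (1 - E.avgLossRate) := by
    have : ∀ i, E.interference i (E.clusterOf i) = 1 - E.lossRate i := fun i => by
      rw [lossRate]; ring
    simp_rw [this, avgLossRate]
    rw [Finset.sum_sub_distrib]
    simp
    field_simp
  have hb : ∑ i, ∑ k, E.interference i k * E.interference i k
      = n * (E.bCoeff + (1 - E.avgLossRate) ^ 2) := by
    rw [E.bCoeff_add_sq hn]
    field_simp
  rw [Finset.sum_add_distrib, ← Finset.mul_sum _ _ (1 / 4 : ℝ)]
  fin_cases a <;> fin_cases b <;>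
    simp [designCoeff, populationGram, Pi.single_apply, hr, hb] <;> field_simp <;> ring

end EgoClustering

/-! ### Moments of the cluster treatments and concentration of the sample Gram matrix. -/

theorem MeasureTheory.memLp_of_ae_abs_le_one {Ω : Type*} [MeasurableSpace Ω] {P : Measure Ω}
    [IsProbabilityMeasure P] {X : Ω → ℝ} (hX : AEMeasurable X P) (hb : ∀ᵐ ω ∂P, |X ω| ≤ 1)
    (p : ENNReal) : MemLp X p P :=
  MemLp.of_bound hX.aestronglyMeasurable 1 hb

theorem ProbabilityTheory.covariance_le_two_of_ae_abs_le_one {Ω : Type*} [MeasurableSpace Ω]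
    {P : Measure Ω} [IsProbabilityMeasure P] {X Y : Ω → ℝ} (hX : AEMeasurable X P)
    (hY : AEMeasurable Y P) (hbX : ∀ᵐ ω ∂P, |X ω| ≤ 1) (hbY : ∀ᵐ ω ∂P, |Y ω| ≤ 1) :
    cov[X, Y; P] ≤ 2 := by
  have hb : ∀ {Z : Ω → ℝ}, (∀ᵐ ω ∂P, |Z ω| ≤ 1) → |∫ ω, Z ω ∂P| ≤ 1 := fun {Z} hZ => by
    have := norm_integral_le_of_norm_le_const (μ := P) (f := Z) (C := 1) hZ
    simpa using this
  rw [covariance_eq_sub (memLp_of_ae_abs_le_one hX hbX 2) (memLp_of_ae_abs_le_one hY hbY 2)]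
  have h1 : |∫ ω, (X * Y) ω ∂P| ≤ 1 := hb (by
    filter_upwards [hbX, hbY] with ω h1 h2
    rw [Pi.mul_apply, abs_mul]
    exact mul_le_one₀ h1 (abs_nonneg _) h2)
  have h2 : |(∫ ω, X ω ∂P) * ∫ ω, Y ω ∂P| ≤ 1 := by
    rw [abs_mul]
    exact mul_le_one₀ (hb hbX) (abs_nonneg _) (hb hbY)
  linarith [(abs_le.1 h1).2, (abs_le.1 h2).1]

namespace IsEgoRandomization

variable {K : ℕ} {Ω : Type*} [MeasurableSpace Ω] {S : Fin K → Ω → ℝ} {P : Measure Ω}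

theorem ae_eq_zero_or_one (hS : IsEgoRandomization S P) :
    ∀ᵐ ω ∂P, ∀ k, S k ω = 0 ∨ S k ω = 1 := by
  refine ae_all_iff.2 fun k => ?_
  have hm : MeasurableSet {x : ℝ | x = 0 ∨ x = 1} :=
    (measurableSet_singleton 0).union (measurableSet_singleton 1)
  rw [(hS.law k).ae_iff (p := fun x => x = 0 ∨ x = 1) (measurableSet_setOfPred.1 hm), fairCoin,
    ae_iff]
  exact bernoulliMeasure_apply_of_notMem_of_notMem _ hm.compl (by simp) (by simp)

theorem integral_eq (hS : IsEgoRandomization S P) (k : Fin K) : ∫ ω, S k ω ∂P = 1 / 2 := by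
  have := (hS.law k).integral_eq
  rw [this, fairCoin, integral_bernoulliMeasure]
  simp

theorem aemeasurable_unitTreatment {n : ℕ} {G : SimpleGraph (Fin n)}
    (hS : IsEgoRandomization S P) (E : EgoClustering G K) :
    AEMeasurable (fun ω => E.unitTreatment fun k => S k ω) P :=
  aemeasurable_pi_lambda _ fun i => (hS.law (E.clusterOf i)).aemeasurable

theorem memLp [IsProbabilityMeasure P] (hS : IsEgoRandomization S P) (k : Fin K) (p : ENNReal) : MemLp (S k) p P := by
  refine memLp_of_ae_abs_le_one (hS.law k).aemeasurable ?_ p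
  filter_upwards [hS.ae_eq_zero_or_one] with ω h
  rcases h k with h | h <;> simp [h]

theorem integral_mul_eq [IsProbabilityMeasure P] (hS : IsEgoRandomization S P) (k l : Fin K) :
    ∫ ω, S k ω * S l ω ∂P = 1 / 4 + if k = l then 1 / 4 else 0 := by
  split_ifs with h
  · subst h
    rw [integral_congr_ae (g := S k), hS.integral_eq]
    · norm_num
    · filter_upwards [hS.ae_eq_zero_or_one] with ω h
      rcases h k with h | h <;> simp [h]
  · have := (hS.indep.indepFun h).integral_fun_mul_eq_mul_integral
      (hS.memLp k 1).aestronglyMeasurable (hS.memLp l 1).aestronglyMeasurable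
    rw [this, hS.integral_eq, hS.integral_eq]
    norm_num

/-- Product of the means plus the covariance; by independence only the diagonal terms contribute to
the latter, each with variance `1/4`. -/
theorem integral_affine_mul_affine [IsProbabilityMeasure P] (hS : IsEgoRandomization S P) (d d' : ℝ) (c c' : Fin K → ℝ) :
    ∫ ω, (d + ∑ k, c k * S k ω) * (d' + ∑ k, c' k * S k ω) ∂P
      = (d + (∑ k, c k) / 2) * (d' + (∑ k, c' k) / 2) + 1 / 4 * ∑ k, c k * c' k := by
  have e : ∀ ω, (d + ∑ k, c k * S k ω) * (d' + ∑ k, c' k * S k ω)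
      = d * d' + ∑ k, (d * c' k + d' * c k) * S k ω
        + ∑ k, ∑ l, c k * c' l * (S k ω * S l ω) := fun ω => by
    have : ∑ k, ∑ l, c k * c' l * (S k ω * S l ω)
        = (∑ k, c k * S k ω) * ∑ k, c' k * S k ω := by
      rw [Finset.sum_mul_sum]
      exact Finset.sum_congr rfl fun k _ => Finset.sum_congr rfl fun l _ => by ring
    rw [this]
    have : ∑ k, (d * c' k + d' * c k) * S k ω
        = d * ∑ k, c' k * S k ω + d' * ∑ k, c k * S k ω := by
      rw [Finset.mul_sum, Finset.mul_sum, ← Finset.sum_add_distrib]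
      exact Finset.sum_congr rfl fun k _ => by ring
    rw [this]
    ring
  have i1 : ∀ k, Integrable (S k) P := fun k => memLp_one_iff_integrable.1 (hS.memLp k 1)
  have i2 : ∀ k l, Integrable (fun ω => S k ω * S l ω) P := fun k l =>
    (hS.memLp k 2).integrable_mul (hS.memLp l 2)
  have j1 : Integrable (fun ω => ∑ k, (d * c' k + d' * c k) * S k ω) P :=
    integrable_finsetSum _ fun k _ => (i1 k).const_mul _
  have j2 : ∀ k, Integrable (fun ω => ∑ l, c k * c' l * (S k ω * S l ω)) P := fun k =>
    integrable_finsetSum _ fun l _ => (i2 k l).const_mul _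
  simp_rw [e]
  rw [integral_add (f := fun ω => d * d' + ∑ k, (d * c' k + d' * c k) * S k ω)
    ((integrable_const _).add j1) (integrable_finsetSum _ fun k _ => j2 k),
    integral_add (integrable_const _) j1, integral_finsetSum _ fun k _ => (i1 k).const_mul _,
    integral_finsetSum _ fun k _ => j2 k]
  have e2 : ∀ k, ∫ ω, ∑ l, c k * c' l * (S k ω * S l ω) ∂P
      = c k * (∑ l, c' l) / 4 + 1 / 4 * (c k * c' k) := fun k => by
    rw [integral_finsetSum _ fun l _ => (i2 k l).const_mul _]
    simp_rw [integral_const_mul, hS.integral_mul_eq, mul_add]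
    rw [Finset.sum_add_distrib, ← Finset.sum_mul, ← Finset.mul_sum]
    simp
    ring
  simp_rw [e2, integral_const_mul, hS.integral_eq]
  rw [Finset.sum_add_distrib, ← Finset.sum_div, ← Finset.sum_mul, ← Finset.sum_mul,
    Finset.sum_add_distrib, ← Finset.mul_sum, ← Finset.mul_sum, ← Finset.mul_sum]
  simp
  ring

variable {n : ℕ} {G : SimpleGraph (Fin n)} {E : EgoClustering G K}

theorem ae_abs_unitTreatment_le_one (hS : IsEgoRandomization S P) (E : EgoClustering G K) :
    ∀ᵐ ω ∂P, ∀ i, |E.unitTreatment (fun k => S k ω) i| ≤ 1 := by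
  filter_upwards [hS.ae_eq_zero_or_one] with ω h i
  rcases h (E.clusterOf i) with h | h <;> simp [EgoClustering.unitTreatment, h]

/-- The `(a, b)` entry of the contribution of unit `i` to the Gram matrix `XᵀX`. -/
noncomputable def gramTerm (E : EgoClustering G K) (S : Fin K → Ω → ℝ) (a b : Fin 3) (i : Fin n) (ω : Ω) : ℝ :=
  designMatrix G (E.unitTreatment fun k => S k ω) i a *
    designMatrix G (E.unitTreatment fun k => S k ω) i b

theorem aemeasurable_gramTerm (hS : IsEgoRandomization S P) (E : EgoClustering G K) (a b : Fin 3)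
    (i : Fin n) : AEMeasurable (gramTerm E S a b i) P :=
  ((measurable_designMatrix G i a).comp_aemeasurable (hS.aemeasurable_unitTreatment E)).mul
    ((measurable_designMatrix G i b).comp_aemeasurable (hS.aemeasurable_unitTreatment E))

theorem ae_abs_gramTerm_le_one (hS : IsEgoRandomization S P) (E : EgoClustering G K) (a b : Fin 3)
    (i : Fin n) : ∀ᵐ ω ∂P, |gramTerm E S a b i ω| ≤ 1 := by
  filter_upwards [hS.ae_abs_unitTreatment_le_one E] with ω h
  rw [gramTerm, abs_mul]
  exact mul_le_one₀ (abs_designMatrix_le_one G h i a) (abs_nonneg _)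
    (abs_designMatrix_le_one G h i b)

theorem integral_gramTerm [IsProbabilityMeasure P] (hS : IsEgoRandomization S P) (E : EgoClustering G K) (a b : Fin 3)
    {i : Fin n} (hi : ∃ j, G.Adj i j) :
    ∫ ω, gramTerm E S a b i ω ∂P
      = (![1, 1 / 2, 1 / 2] : Fin 3 → ℝ) a * (![1, 1 / 2, 1 / 2] : Fin 3 → ℝ) b
        + 1 / 4 * ∑ k, E.designCoeff i a k * E.designCoeff i b k := by
  simp only [gramTerm, E.designMatrix_unitTreatment]
  rw [hS.integral_affine_mul_affine, E.sum_designCoeff hi, E.sum_designCoeff hi]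
  congr 1
  fin_cases a <;> fin_cases b <;> simp

theorem indepFun_gramTerm (hS : IsEgoRandomization S P) (E : EgoClustering G K) (a b : Fin 3)
    {i j : Fin n} (hij : Disjoint (E.reach i) (E.reach j)) :
    IndepFun (gramTerm E S a b i) (gramTerm E S a b j) P := by
  have h := hS.indep.indepFun_finset₀ _ _ hij fun k => (hS.law k).aemeasurable
  -- A design row as a function of the treatments in `reach i` alone; disjoint reaches then involve
  -- disjoint subfamilies of an independent family.
  let φ : (i : Fin n) → Fin 3 → (E.reach i → ℝ) → ℝ := fun i a u =>
    (![1, 0, 0] : Fin 3 → ℝ) a + ∑ k : E.reach i, E.designCoeff i a k * u k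
  have hφ : ∀ i a, Measurable (φ i a) := fun i a => 
    (measurable_sum_mul fun k : E.reach i => E.designCoeff i a k).const_add _
  have e : ∀ i, gramTerm E S a b i
      = (fun u => φ i a u * φ i b u) ∘ fun ω (k : E.reach i) => S k ω := by
    intro i
    have hs : ∀ a ω, ∑ k, E.designCoeff i a k * S k ω
        = ∑ k : E.reach i, E.designCoeff i a k * S k ω := by
      intro a ω
      rw [Finset.sum_coe_sort (E.reach i) fun k => E.designCoeff i a k * S k ω]
      refine (Finset.sum_subset (Finset.subset_univ _) fun k _ hk => ?_).symm
      rw [E.designCoeff_eq_zero hk, zero_mul]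
    funext ω
    simp only [gramTerm, E.designMatrix_unitTreatment, hs, Function.comp_apply, φ]
  rw [e i, e j]
  exact h.comp ((hφ i a).mul (hφ i b)) ((hφ j a).mul (hφ j b))

/-- Covariances vanish outside the dependence sets and are at most `2` inside them. -/
theorem variance_sum_gramTerm_le [IsProbabilityMeasure P] (hS : IsEgoRandomization S P) (E : EgoClustering G K)
    (a b : Fin 3) :
    Var[fun ω => ∑ i, gramTerm E S a b i ω; P] ≤ 2 * ∑ i, ((E.depSet i).card : ℝ) := by
  have hL : ∀ i, MemLp (gramTerm E S a b i) 2 P := fun i =>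
    memLp_of_ae_abs_le_one (hS.aemeasurable_gramTerm E a b i) (hS.ae_abs_gramTerm_le_one E a b i) 2
  rw [variance_fun_sum hL, Finset.mul_sum]
  refine Finset.sum_le_sum fun i _ => ?_
  have : ∀ j, cov[gramTerm E S a b i, gramTerm E S a b j; P]
      ≤ if j ∈ E.depSet i then 2 else 0 := by
    intro j
    split_ifs with h
    · exact covariance_le_two_of_ae_abs_le_one (hS.aemeasurable_gramTerm E a b i)
        (hS.aemeasurable_gramTerm E a b j) (hS.ae_abs_gramTerm_le_one E a b i)
        (hS.ae_abs_gramTerm_le_one E a b j)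
    · have hd : Disjoint (E.reach i) (E.reach j) := by
        rw [Finset.disjoint_iff_inter_eq_empty, ← Finset.not_nonempty_iff_eq_empty]
        simpa [EgoClustering.depSet] using h
      exact ((hS.indepFun_gramTerm E a b hd).covariance_eq_zero (hL i) (hL j)).le
  refine (Finset.sum_le_sum fun j _ => this j).trans (le_of_eq ?_)
  rw [Finset.sum_ite_mem]
  simp
  ring

theorem measure_sampleGram_sub_le [IsProbabilityMeasure P] (hS : IsEgoRandomization S P) (E : EgoClustering G K)
    (hn : 0 < n) (hdeg : ∀ i, ∃ j, G.Adj i j) (a b : Fin 3) {δ : ℝ} (hδ : 0 < δ) :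
    P {ω | δ ≤ |sampleGram G (E.unitTreatment fun k => S k ω) a b
        - populationGram E.avgLossRate E.bCoeff a b|}
      ≤ ENNReal.ofReal ((n : ℝ)⁻¹ ^ 2 * (2 * ∑ i, ((E.depSet i).card : ℝ)) / δ ^ 2) := by
  have hL : ∀ i, MemLp (gramTerm E S a b i) 2 P := fun i =>
    memLp_of_ae_abs_le_one (hS.aemeasurable_gramTerm E a b i) (hS.ae_abs_gramTerm_le_one E a b i) 2
  have hLs : MemLp (fun ω => (n : ℝ)⁻¹ * ∑ i, gramTerm E S a b i ω) 2 P :=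
    (memLp_finsetSum _ fun i _ => hL i).const_mul _
  have e : ∀ ω, sampleGram G (E.unitTreatment fun k => S k ω) a b
      = (n : ℝ)⁻¹ * ∑ i, gramTerm E S a b i ω := fun ω => by
    simp [sampleGram, Matrix.mul_apply, gramTerm]
  have hmean : ∫ ω, (n : ℝ)⁻¹ * ∑ i, gramTerm E S a b i ω ∂P
      = populationGram E.avgLossRate E.bCoeff a b := by
    rw [integral_const_mul, integral_finsetSum _ fun i _ => (hL i).integrable (by norm_num),
      ← E.mean_designCoeff hn]
    simp_rw [fun i => hS.integral_gramTerm E a b (hdeg i)]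
  have h := meas_ge_le_variance_div_sq hLs hδ
  rw [hmean] at h
  simp_rw [e]
  refine h.trans (ENNReal.ofReal_le_ofReal ?_)
  rw [variance_const_mul]
  gcongr
  exact hS.variance_sum_gramTerm_le E a b

end IsEgoRandomization

/-! ### Limits in `n`: concentration, invertibility, asymptotic normality. -/

/-- Treatment vectors whose normalized Gram matrix is within `δ` of its expectation. -/
noncomputable def EgoClustering.concentrationSet {n K : ℕ} {G : SimpleGraph (Fin n)} (E : EgoClustering G K)
    (δ : ℝ) : Set (Fin n → ℝ) :=
  {x | (∀ i, |x i| ≤ 1) ∧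
    ∀ a b, |sampleGram G x a b - populationGram E.avgLossRate E.bCoeff a b| < δ}

theorem EgoClustering.measurableSet_concentrationSet {n K : ℕ} {G : SimpleGraph (Fin n)}
    (E : EgoClustering G K) (δ : ℝ) : MeasurableSet (E.concentrationSet δ) := by
  have h1 : MeasurableSet {x : Fin n → ℝ | ∀ i, |x i| ≤ 1} := by
    rw [Set.ofPred_forall]
    exact MeasurableSet.iInter fun i => measurableSet_le (by fun_prop) measurable_const
  have h2 : MeasurableSet {x : Fin n → ℝ | ∀ a b,
      |sampleGram G x a b - populationGram E.avgLossRate E.bCoeff a b| < δ} := by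
    simp_rw [Set.ofPred_forall]
    exact MeasurableSet.iInter fun a => MeasurableSet.iInter fun b =>
      measurableSet_lt ((measurable_sampleGram G a b).sub_const _).abs measurable_const
  exact h1.inter h2

/-- Since `|N_i| ≤ |N_i|²`, the quantity is at most `n⁻¹` times a mean of order `o(√n)`. -/
theorem tendsto_sum_depSet_card_div_sq {K : ℕ → ℕ} {G : (n : ℕ) → SimpleGraph (Fin n)}
    (E : (n : ℕ) → EgoClustering (G n) (K n))
    (h_dep2 : (fun n => (∑ i, ((E n).depSet i).card ^ 2 : ℝ) / (n : ℝ))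
      =o[atTop] fun n => √(n : ℝ)) :
    Tendsto (fun n : ℕ => (n : ℝ)⁻¹ ^ 2 * ∑ i, (((E n).depSet i).card : ℝ)) atTop (𝓝 0) := by
  have h1 : (fun n : ℕ => √(n : ℝ)) =O[atTop] fun n : ℕ => (n : ℝ) := by
    refine IsBigO.of_bound 1 (eventually_atTop.2 ⟨1, fun n hn => ?_⟩)
    have hn' : (1 : ℝ) ≤ n := by exact_mod_cast hn
    rw [Real.norm_of_nonneg (by positivity), Real.norm_of_nonneg (by positivity), one_mul,
      Real.sqrt_le_left (by positivity)]
    nlinarith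
  have h2 := (h_dep2.trans_isBigO h1).tendsto_div_nhds_zero
  refine squeeze_zero (fun n => by positivity) (fun n => ?_) h2
  rw [div_div, div_eq_inv_mul, ← sq, inv_pow]
  gcongr with i
  exact_mod_cast Nat.le_self_pow (by norm_num) _

section

variable {G : (n : ℕ) → SimpleGraph (Fin n)} {K : ℕ → ℕ} (E : (n : ℕ) → EgoClustering (G n) (K n))
  {Ω : ℕ → Type*} [∀ n, MeasurableSpace (Ω n)] {P : (n : ℕ) → Measure (Ω n)}
  [∀ n, IsProbabilityMeasure (P n)] {S : (n : ℕ) → Fin (K n) → Ω n → ℝ}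

theorem tendsto_measure_notMem_concentrationSet
    (h_deg : ∀ᶠ n in atTop, ∀ i, ∃ j, (G n).Adj i j)
    (h_design : ∀ n, IsEgoRandomization (S n) (P n))
    (h_dep2 : (fun n => (∑ i, ((E n).depSet i).card ^ 2 : ℝ) / (n : ℝ))
      =o[atTop] fun n => √(n : ℝ)) {δ : ℝ} (hδ : 0 < δ) :
    Tendsto (fun n => P n {ω | ((E n).unitTreatment fun k => S n k ω) ∉
      (E n).concentrationSet δ}) atTop (𝓝 0) := by
  let u : ℕ → ENNReal := fun n => ENNReal.ofReal
    ((n : ℝ)⁻¹ ^ 2 * (2 * ∑ i, (((E n).depSet i).card : ℝ)) / δ ^ 2)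
  have hu : Tendsto u atTop (𝓝 0) := by
    have h := ((tendsto_sum_depSet_card_div_sq E h_dep2).const_mul 2).div_const (δ ^ 2)
    simp only [mul_zero, zero_div] at h
    have h' := ENNReal.tendsto_ofReal h
    rw [ENNReal.ofReal_zero] at h'
    refine h'.congr fun n => ?_
    simp only [u]
    congr 2
    ring
  have hsum : Tendsto (fun n => ∑ _a : Fin 3, ∑ _b : Fin 3, u n) atTop (𝓝 0) := by
    have : Tendsto (fun n => ∑ _a : Fin 3, ∑ _b : Fin 3, u n) atTop
        (𝓝 (∑ _a : Fin 3, ∑ _b : Fin 3, 0)) :=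
      tendsto_finsetSum _ fun a _ => tendsto_finsetSum _ fun b _ => hu
    simpa using this
  refine tendsto_of_tendsto_of_tendsto_of_le_of_le' tendsto_const_nhds hsum
    (Eventually.of_forall fun n => zero_le) ?_
  filter_upwards [h_deg, eventually_gt_atTop 0] with n hdeg hn
  have hae := (h_design n).ae_abs_unitTreatment_le_one (E n)
  -- The treatments take values in `{0, 1}` only almost surely, so the inclusion holds up to a null
  -- set.
  have hsub : {ω | ((E n).unitTreatment fun k => S n k ω) ∉ (E n).concentrationSet δ}
      ≤ᵐ[P n] ⋃ a : Fin 3, ⋃ b : Fin 3,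
        {ω | δ ≤ |sampleGram (G n) ((E n).unitTreatment fun k => S n k ω) a b
          - populationGram (E n).avgLossRate (E n).bCoeff a b|} := by
    filter_upwards [hae] with ω h1 (h2 : _ ∉ _)
    by_contra h3
    refine h2 ⟨h1, fun a b => lt_of_not_ge fun h4 => h3 ?_⟩
    exact Set.mem_iUnion.2 ⟨a, Set.mem_iUnion.2 ⟨b, h4⟩⟩
  refine (measure_mono_ae hsub).trans ((measure_iUnion_fintype_le _ _).trans
    (Finset.sum_le_sum fun a _ => (measure_iUnion_fintype_le _ _).trans
      (Finset.sum_le_sum fun b _ => ?_)))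
  exact (h_design n).measure_sampleGram_sub_le (E n) hn hdeg a b hδ

theorem tendsto_measure_det_ne_zero {c₀ : ℝ} (hc₀ : 0 < c₀)
    (h_deg : ∀ᶠ n in atTop, ∀ i, ∃ j, (G n).Adj i j)
    (h_design : ∀ n, IsEgoRandomization (S n) (P n))
    (h_net : ∀ᶠ n in atTop, c₀ < max (E n).spread (E n).lossVariability)
    (h_dep2 : (fun n => (∑ i, ((E n).depSet i).card ^ 2 : ℝ) / (n : ℝ))
      =o[atTop] fun n => √(n : ℝ)) :
    Tendsto (fun n => P n {ω |
      ((designMatrix (G n) ((E n).unitTreatment fun k => S n k ω))ᵀ *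
        designMatrix (G n) ((E n).unitTreatment fun k => S n k ω)).det ≠ 0}) atTop (𝓝 1) := by
  -- Only the nonvanishing determinant matters here, so the choices `l = 0` and `η = 1` are
  -- arbitrary.
  obtain ⟨δ, hδ, C, -, h⟩ := exists_inv_near_populationGram 0 hc₀ one_pos
  have hbad := tendsto_measure_notMem_concentrationSet E h_deg h_design h_dep2 hδ
  have hlow := ENNReal.Tendsto.sub (tendsto_const_nhds (x := (1 : ENNReal))) hbad
    (Or.inl ENNReal.one_ne_top)
  rw [tsub_zero] at hlow
  refine tendsto_of_tendsto_of_tendsto_of_le_of_le' hlow tendsto_const_nhds ?_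
    (Eventually.of_forall fun n => prob_le_one)
  filter_upwards [h_deg, h_net, eventually_gt_atTop 0] with n hdeg hnet hn
  rw [tsub_le_iff_right, ← measure_univ (μ := P n)]
  refine (measure_mono fun ω _ => ?_).trans (measure_union_le _ _)
  by_cases hω : ((E n).unitTreatment fun k => S n k ω) ∈ (E n).concentrationSet δ
  · left
    exact (gram_inv_eq hn _ _ (h _ ((E n).avgLossRate_mem_Icc hdeg) _
      ⟨hnet.le.trans (E n).max_le_bCoeff, (E n).bCoeff_le_one hdeg⟩ _ hω.2).1).1
  · exact Or.inr hω

/-- Asymptotic normality of the least squares estimator of a linear combination of the regression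
coefficients. -/
theorem tendstoInDistribution_dotProduct_olsEstimator
    {ε : (n : ℕ) → Fin n → Ω n → ℝ} (α β γ : ℝ) {σ c₀ M : ℝ} (hσ : 0 < σ) (hc₀ : 0 < c₀)
    (h_deg : ∀ᶠ n in atTop, ∀ i, ∃ j, (G n).Adj i j)
    (h_design : ∀ n, IsEgoRandomization (S n) (P n))
    (h_err : ∀ n, IsIIDError (ε n) σ (P n))
    (h_indep : ∀ n, IndepFun (fun ω i => ε n i ω)
      (fun ω => (E n).unitTreatment fun k => S n k ω) (P n))
    (h_int : ∀ n i, Integrable (fun ω => ε n i ω ^ 4) (P n))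
    (h_four : ∀ n i, ∫ ω, ε n i ω ^ 4 ∂(P n) ≤ M)
    (h_net : ∀ᶠ n in atTop, c₀ < max (E n).spread (E n).lossVariability)
    (h_dep2 : (fun n => (∑ i, ((E n).depSet i).card ^ 2 : ℝ) / (n : ℝ))
      =o[atTop] fun n => √(n : ℝ))
    {l : Fin 3 → ℝ} (hl : ∀ j, |l j| ≤ 1) (v : ℕ → ℝ)
    (hv : ∀ᶠ n in atTop, 1 ≤ v n ∧
      l ⬝ᵥ ((populationGram (E n).avgLossRate (E n).bCoeff)⁻¹ *ᵥ l) = v n) :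
    TendstoInDistribution
      (fun n ω => (√(σ ^ 2 * v n))⁻¹ * (√(n : ℝ) *
        (l ⬝ᵥ olsEstimator (G n) ((E n).unitTreatment fun k => S n k ω)
          (outcome (G n) α β γ ((E n).unitTreatment fun k => S n k ω) fun i => ε n i ω)
          - l ⬝ᵥ ![α, β, γ])))
      atTop (id : ℝ → ℝ) P (gaussianReal 0 1) := by
  refine tendstoInDistribution_of_random_weights hσ h_err
    (fun n => (h_design n).aemeasurable_unitTreatment (E n)) h_indep h_int h_four
    (F := fun n x e => (√(σ ^ 2 * v n))⁻¹ * (√(n : ℝ) *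
        (l ⬝ᵥ olsEstimator (G n) x (outcome (G n) α β γ x e) - l ⬝ᵥ ![α, β, γ]))) (fun n => ?_)
    (fun n x i => (√(σ ^ 2 * v n))⁻¹ * √(n : ℝ) * olsWeight (G n) l x i) fun η hη => ?_
  · refine measurable_const.mul (measurable_const.mul (Measurable.sub_const ?_ _))
    exact Finset.measurable_sum _ fun j _ =>
      measurable_const.mul (measurable_olsEstimator_outcome (G n) α β γ j)
  -- The tolerance `σ² η` absorbs the factor `(σ²)⁻¹` from the normalization; the remaining `(v
  -- n)⁻¹` is at most `1`.
  · obtain ⟨δ, hδ, C, hC, h⟩ := exists_inv_near_populationGram l hc₀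
      (by positivity : 0 < σ ^ 2 * η)
    refine ⟨fun n => (E n).concentrationSet δ, fun n => (E n).measurableSet_concentrationSet δ,
      tendsto_measure_notMem_concentrationSet E h_deg h_design h_dep2 hδ, ?_⟩
    -- Bound on the normalized weights: `σ⁻¹ √n` times the leverage bound `n⁻¹ (9 C)`.
    have hlim : Tendsto (fun n : ℕ => σ⁻¹ * (9 * C) * (√(n : ℝ))⁻¹) atTop (𝓝 0) := by
      have := (tendsto_inv_atTop_zero.comp (Real.tendsto_sqrt_atTop.comp
        tendsto_natCast_atTop_atTop)).const_mul (σ⁻¹ * (9 * C))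
      simpa [Function.comp_def] using this
    filter_upwards [h_deg, h_net, hv, eventually_gt_atTop 0, hlim.eventually_le_const hη] with
      n hdeg hnet hvn hn hsmall x hx
    obtain ⟨hv1, hvn⟩ := hvn
    obtain ⟨hdet, hq, hinv⟩ := h _ ((E n).avgLossRate_mem_Icc hdeg) _
      ⟨hnet.le.trans (E n).max_le_bCoeff, (E n).bCoeff_le_one hdeg⟩ _ hx.2
    rw [hvn] at hq
    have hn' : (0 : ℝ) < n := by exact_mod_cast hn
    have hv0 : 0 < v n := by linarith
    have hs : σ ≤ √(σ ^ 2 * v n) := by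
      apply Real.le_sqrt_of_sq_le
      nlinarith [sq_nonneg σ]
    refine ⟨fun e => ?_, ?_, fun i => ?_⟩
    · rw [dotProduct_olsEstimator_outcome _ _ _ _ _ _ _ (gram_inv_eq hn _ _ hdet).1,
        Finset.mul_sum, Finset.mul_sum]
      exact Finset.sum_congr rfl fun i _ => by ring
    · simp_rw [mul_pow]
      rw [← Finset.mul_sum, sum_olsWeight_sq_eq_sampleGram hn _ _ _ hdet, inv_pow,
        Real.sq_sqrt (by positivity), Real.sq_sqrt (by positivity)]
      set q := l ⬝ᵥ ((sampleGram (G n) x)⁻¹ *ᵥ l)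
      have : (σ ^ 2 * v n)⁻¹ * n * ((n : ℝ)⁻¹ * q) - (σ ^ 2)⁻¹
          = (σ ^ 2)⁻¹ * (v n)⁻¹ * (q - v n) := by
        field_simp
      rw [this, abs_mul, abs_of_pos (by positivity)]
      calc (σ ^ 2)⁻¹ * (v n)⁻¹ * |q - v n| ≤ (σ ^ 2)⁻¹ * 1 * (σ ^ 2 * η) := by
            gcongr
            exact inv_le_one_of_one_le₀ hv1
        _ = η := by field_simp
    · rw [abs_mul, abs_of_nonneg (by positivity)]
      refine le_trans ?_ hsmall
      calc _ ≤ σ⁻¹ * √(n : ℝ) * ((n : ℝ)⁻¹ * (9 * C)) := by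
            gcongr
            exact abs_olsWeight_le hn (G n) hl hx.1 hdet hinv i
        _ = _ := by
            have : (n : ℝ)⁻¹ = (√(n : ℝ))⁻¹ * (√(n : ℝ))⁻¹ := by
              rw [← mul_inv, Real.mul_self_sqrt hn'.le]
            have h0 : √(n : ℝ) ≠ 0 := by positivity
            rw [this]
            field_simp

end
theorem theorem2
    -- for each number `n` of units: a network and its ego-clustering
    (G : (n : ℕ) → SimpleGraph (Fin n))
    (K : ℕ → ℕ) (E : (n : ℕ) → EgoClustering (G n) (K n))
    -- the cluster treatments `S` and the errors `ε` of the `n`-th experiment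
    (Ω : ℕ → Type*) [∀ n, MeasurableSpace (Ω n)]
    (P : (n : ℕ) → Measure (Ω n)) [∀ n, IsProbabilityMeasure (P n)]
    (S : (n : ℕ) → Fin (K n) → Ω n → ℝ)
    (ε : (n : ℕ) → Fin n → Ω n → ℝ)
    -- the induced treatments of the units and the outcomes
    (T Y : (n : ℕ) → Ω n → Fin n → ℝ)
    (α β γ σ c₀ M : ℝ) (hσ : 0 < σ) (hc₀ : 0 < c₀)
    (hT : ∀ n ω, T n ω = (E n).unitTreatment fun k => S n k ω)
    (hY : ∀ n ω, Y n ω = outcome (G n) α β γ (T n ω) fun i => ε n i ω)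
    -- no unit is isolated
    (h_deg : ∀ᶠ n in atTop, ∀ i, ∃ j, (G n).Adj i j)
    -- the design
    (h_size : (fun n => ((E n).maxClusterSize : ℝ)) =o[atTop] fun n => (n : ℝ))
    (h_design : ∀ n, IsEgoRandomization (S n) (P n))
    -- the errors
    (h_err : ∀ n, IsIIDError (ε n) σ (P n))
    (h_indep : ∀ n, IndepFun (fun ω i => ε n i ω) (T n) (P n))
    (h_int : ∀ n i, Integrable (fun ω => ε n i ω ^ 4) (P n))
    (h_four : ∀ n i, ∫ ω, ε n i ω ^ 4 ∂(P n) ≤ M)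
    -- nondegeneracy of the interference matrix or of the loss rates
    (h_net : ∀ᶠ n in atTop, c₀ < max (E n).spread (E n).lossVariability)
    -- moments of the dependency graph
    (h_dep2 : (fun n => (∑ i, ((E n).depSet i).card ^ 2 : ℝ) / (n : ℝ))
      =o[atTop] fun n => √(n : ℝ))
    (h_dep3 : (fun n => (∑ i, ((E n).depSet i).card ^ 3 : ℝ) / (n : ℝ))
      =o[atTop] fun n => (n : ℝ))
    (h_walk : (fun n => (∑ i, ∑ j, ((E n).depMatrix ^ 3) i j) / (n : ℝ))
      =o[atTop] fun n => (n : ℝ)) :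
    -- the estimators are well defined with probability tending to one
    Tendsto (fun n => P n {ω | ((designMatrix (G n) (T n ω))ᵀ * designMatrix (G n) (T n ω)).det ≠ 0})
      atTop (𝓝 1) ∧
    TendstoInDistribution
      (fun n ω => (√(4 * σ ^ 2 * ((E n).avgLossRate ^ 2 / (E n).bCoeff + 1)))⁻¹ *
        (√(n : ℝ) * (tauHat (G n) (T n ω) (Y n ω) - (β + γ))))
      atTop (id : ℝ → ℝ) P (gaussianReal 0 1) ∧
    TendstoInDistribution
      (fun n ω => (√(4 * σ ^ 2 / (E n).bCoeff))⁻¹ *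
        (√(n : ℝ) * (gammaHat (G n) (T n ω) (Y n ω) - γ)))
      atTop (id : ℝ → ℝ) P (gaussianReal 0 1) := by
  obtain rfl : T = fun n ω => (E n).unitTreatment fun k => S n k ω := funext₂ hT
  obtain rfl : Y = fun n ω => outcome (G n) α β γ ((E n).unitTreatment fun k => S n k ω)
      fun i => ε n i ω := funext₂ hY
  -- Positivity makes the variance formulas valid; `b ≤ 1` gives `4 / b ≥ 1`, the lower bound
  -- required of `v` for `γ̂`.
  have hb : ∀ᶠ n in atTop, 0 < (E n).bCoeff ∧ (E n).bCoeff ≤ 1 := by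
    filter_upwards [h_deg, h_net] with n hdeg hnet
    exact ⟨(hc₀.trans hnet).trans_le (E n).max_le_bCoeff, (E n).bCoeff_le_one hdeg⟩
  refine ⟨tendsto_measure_det_ne_zero E hc₀ h_deg h_design h_net h_dep2, ?_, ?_⟩
  · have := tendstoInDistribution_dotProduct_olsEstimator E α β γ hσ hc₀ h_deg h_design h_err
      h_indep h_int h_four h_net h_dep2 (l := ![0, 1, 1])
      (fun j => by fin_cases j <;> simp)
      (fun n => 4 * ((E n).avgLossRate ^ 2 / (E n).bCoeff + 1)) (by
        filter_upwards [hb] with n hbn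
        refine ⟨?_, dotProduct_inv_populationGram_total hbn.1.ne'⟩
        have : 0 ≤ (E n).avgLossRate ^ 2 / (E n).bCoeff := div_nonneg (sq_nonneg _) hbn.1.le
        linarith)
    convert! this using 5 with n ω
    · congr 1
      ring
    · simp [tauHat, dotProduct, Fin.sum_univ_three]
  · have := tendstoInDistribution_dotProduct_olsEstimator E α β γ hσ hc₀ h_deg h_design h_err
      h_indep h_int h_four h_net h_dep2 (l := ![0, 0, 1])
      (fun j => by fin_cases j <;> simp) (fun n => 4 / (E n).bCoeff) (by
        filter_upwards [hb] with n hbn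
        refine ⟨?_, dotProduct_inv_populationGram_spillover hbn.1.ne'⟩
        rw [le_div_iff₀ hbn.1]
        linarith [hbn.2])
    convert! this using 5 with n ω
    · congr 1
      ring
    · simp [gammaHat, dotProduct, Fin.sum_univ_three]
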